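/- **Setting.** Fix dimensions $p,p_1,p_2$, a teacher $(W_1^*,W_2^*)\in\mathbb R^{p_1\times p}\times\mathbb R^{p_2\times p_1}$ and step sizes $\alpha_0,\alpha_1,\ldots\in\mathbb R$. For a mini-batch size $b\ge 1$, let $(W_{0,1},W_{0,2})$ be (possibly random) initial weights of the same sizes, let $x_{t,i}$ ($t\ge 0$, $1\le i\le b$) be i.i.d. $\mathcal N(0,I_p)$ vectors independent of the initial weights, and run online SGD from $W_{0,1}^b=W_{0,1}$, $W_{0,2}^b=W_{0,2}$: $$W_{t+1,1}^b=W_{t,1}^b-\alpha_t g_{t,1}^b,\qquad W_{t+1,2}^b=W_{t,2}^b-\alpha_t g_{t,2}^b,$$ $$g_{t,j}^b=\frac1b\sum_{i=1}^b\nabla_{W_{t,j}^b}\Big(\tfrac12\big\|W_{t,2}^bW_{t,1}^bx_{t,i}-W_2^*W_1^*x_{t,i}\big\|^2\Big),\quad j=1,2 .$$ Let $\mathcal F_0$ be the $\sigma$-algebra generated by $(W_{0,1},W_{0,2})$. A *multiplicative term* of parameter matrices $\mathcal X$ and constant matrices $\mathcal C$ is a formal product $A_1A_2\cdots A_k$ ($k\ge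 0$, of compatible sizes) of matrices of $\mathcal X\cup\mathcal C$ and their transposes; an empty product is an identity matrix. Its degree $\deg(X;\cdot)$ in a matrix $X$ is the number of factors that are $X$ or $X^\top$, and its degree is the sum of its degrees in the parameter matrices. **Theorem.** Let $t\ge 0$ and let $M_0,M_1,\ldots,M_m$ be multiplicative terms of parameter matrices $\{g_{t,1}^b,g_{t,2}^b\}$ and constant matrices $\{W_{t,1}^b,W_{t,2}^b,W_1^*,W_2^*\}$, with $M_1,\ldots,M_m$ square. Put $$M=\prod_{i=1}^m\operatorname{tr}(M_i)\,M_0,\qquad d=\sum_{i=0}^m\deg(M_i),\qquad d'=\sum_{i=0}^m\big(\deg(W_{t,1}^b;M_i)+\deg(W_{t,2}^b;M_i)\big).$$ There exist an integer $0\le q\le\frac12(3^{t+1}-1)d+\frac12(3^t-1)d'$, integers $m_k,m_{ki}\ge0$, real numbers $c_{ki}$ that are polynomials with integer coefficients in $\alpha_0,\ldots,\alpha_{t-1}$, and multiplicative terms $M_{ij}^k$ ($0\le k\le q$, $1\le i\le m_k$, $0\le j\le m_{ki}$) of parameter matrices $\{W_{0,1},W_{0,2}\}$ and constant matrices $\{W_1^*,W_2^*\}$,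 such that $$\sum_{j=0}^{m_{ki}}\deg(M_{ij}^k)\le 3^t(3d+d')\quad\text{for all }k,i,$$ and such that, with $N_k=\sum_{i=1}^{m_k}c_{ki}\prod_{j=1}^{m_{ki}}\operatorname{tr}(M_{ij}^k)\,M_{i0}^k$, $$\mathbb E[M\mid\mathcal F_0]=N_0+N_1\frac1b+\cdots+N_q\frac1{b^q}\quad\text{almost surely}.$$ Here $q$, $m_k$, $m_{ki}$, $c_{ki}$ and the formal products $M_{ij}^k$ depend neither on $b$, nor on the initial weights, nor on the teacher matrices. The identity holds for each entry of $M$ that is integrable, and every entry is integrable if all entries of the initial weights have finite moments of all orders, in particular if the initial weights are deterministic. -/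

import Mathlib

open MeasureTheory ProbabilityTheory Matrix

/-! ### Multiplicative terms -/

/-- A multiplicative term over the alphabet `ι`, as a formal product (word) in the letters `s : ι`
and their transposes. The letter `s` stands for a matrix of size `r s × c s`, and only products whose
sizes match can be formed: the elements of `MulTerm r c a n` are products of size `a × n`.
The empty product is an identity matrix. -/
inductive MulTerm {ι : Type} (r c : ι → ℕ) : ℕ → ℕ → Type
  | one (n : ℕ) : MulTerm r c n n
  | mul {n : ℕ} (s : ι) (w : MulTerm r c (c s) n) : MulTerm r c (r s) n
  | mulT {n : ℕ} (s : ι) (w : MulTerm r c (r s) n) : MulTerm r c (c s) n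

namespace MulTerm

variable {ι : Type} {r c : ι → ℕ}

/-- The matrix obtained by substituting the matrix `V s` for each letter `s`. -/
def eval (V : (s : ι) → Matrix (Fin (r s)) (Fin (c s)) ℝ) :
    {a n : ℕ} → MulTerm r c a n → Matrix (Fin a) (Fin n) ℝ
  | _, _, one _ => 1
  | _, _, mul s w => V s * w.eval V
  | _, _, mulT s w => (V s)ᵀ * w.eval V

/-- The degree of the letter `s`: its number of occurrences, transposed or not. -/
def deg [DecidableEq ι] (s : ι) : {a n : ℕ} → MulTerm r c a n → ℕ
  | _, _, one _ => 0
  | _, _, mul s' w => (if s' = s then 1 else 0) + w.deg s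
  | _, _, mulT s' w => (if s' = s then 1 else 0) + w.deg s

end MulTerm

/-- A formal product `tr(M₁) ⋯ tr(Mₘ) M₀` of traces of (square) multiplicative terms `M₁, …, Mₘ`
and one multiplicative term `M₀` of size `a × n`. -/
structure TraceProduct {ι : Type} (r c : ι → ℕ) (a n : ℕ) where
  /-- The terms `M₁, …, Mₘ` under the traces, each with its size. -/
  traces : List (Σ k : ℕ, MulTerm r c k k)
  /-- The term `M₀`. -/
  head : MulTerm r c a n

namespace TraceProduct

variable {ι : Type} {r c : ι → ℕ} {a n : ℕ}

/-- The matrix `tr(M₁) ⋯ tr(Mₘ) M₀` when `V s` is substituted for each letter `s`. -/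
def eval (V : (s : ι) → Matrix (Fin (r s)) (Fin (c s)) ℝ) (M : TraceProduct r c a n) :
    Matrix (Fin a) (Fin n) ℝ :=
  (M.traces.map fun T => (T.2.eval V).trace).prod • M.head.eval V

/-- The degree of the letter `s`, summed over `M₀, M₁, …, Mₘ`. -/
def deg [DecidableEq ι] (s : ι) (M : TraceProduct r c a n) : ℕ :=
  (M.traces.map fun T => T.2.deg s).sum + M.head.deg s

end TraceProduct

/-- The value of a finite formal linear combination of trace products. -/
def evalSum {ι : Type} {r c : ι → ℕ} {a n : ℕ}
    (V : (s : ι) → Matrix (Fin (r s)) (Fin (c s)) ℝ) (N : List (ℝ × TraceProduct r c a n)) :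
    Matrix (Fin a) (Fin n) ℝ :=
  (N.map fun s => s.1 • s.2.eval V).sum

/-! ### Two-layer linear networks and online SGD -/

/-- The weights `(W₁, W₂)` of a two-layer linear network `x ↦ W₂ W₁ x` with input dimension `p`,
hidden dimension `p₁` and output dimension `p₂`. -/
abbrev Weights (p p₁ p₂ : ℕ) : Type :=
  Matrix (Fin p₁) (Fin p) ℝ × Matrix (Fin p₂) (Fin p₁) ℝ

/-- The usual Borel (product) σ-algebra on real matrices. -/
instance instMeasurableSpaceRealMatrix {m n : ℕ} :
    MeasurableSpace (Matrix (Fin m) (Fin n) ℝ) :=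
  inferInstanceAs (MeasurableSpace (Fin m → Fin n → ℝ))

section Network

variable {p p₁ p₂ : ℕ}

/-- The loss `½ ‖W₂ W₁ x - W₂* W₁* x‖²` of the student `W` on the sample `x`, with teacher `S`. -/
noncomputable def sampleLoss (S W : Weights p p₁ p₂) (x : EuclideanSpace ℝ (Fin p)) : ℝ :=
  1 / 2 * ‖WithLp.toLp 2 ((W.2 * W.1) *ᵥ x.ofLp - (S.2 * S.1) *ᵥ x.ofLp)‖ ^ 2

/-- The gradient of the sample loss with respect to `W₁`: the matrix of partial derivatives. -/
noncomputable def sampleGrad₁ (S W : Weights p p₁ p₂) (x : EuclideanSpace ℝ (Fin p)) :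
    Matrix (Fin p₁) (Fin p) ℝ :=
  Matrix.of fun i j => deriv (fun h : ℝ => sampleLoss S (W.1 + h • Matrix.single i j (1 : ℝ), W.2) x) 0

/-- The gradient of the sample loss with respect to `W₂`: the matrix of partial derivatives. -/
noncomputable def sampleGrad₂ (S W : Weights p p₁ p₂) (x : EuclideanSpace ℝ (Fin p)) :
    Matrix (Fin p₂) (Fin p₁) ℝ :=
  Matrix.of fun i j => deriv (fun h : ℝ => sampleLoss S (W.1, W.2 + h • Matrix.single i j (1 : ℝ)) x) 0

/-- `d/dh ½ ‖u + h v‖² = v ⬝ u` at `h = 0`. -/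
theorem hasDerivAt_half_normSq {k : ℕ} (u v : Fin k → ℝ) :
    HasDerivAt (fun h : ℝ => 1 / 2 * ‖WithLp.toLp 2 (u + h • v)‖ ^ 2) (v ⬝ᵥ u) 0 := by
  have hfun : (fun h : ℝ => 1 / 2 * ‖WithLp.toLp 2 (u + h • v)‖ ^ 2) =
      fun h : ℝ => ∑ i, 1 / 2 * (u i + h * v i) ^ 2 := by
    funext h
    rw [EuclideanSpace.norm_sq_eq, Finset.mul_sum]
    simp
  rw [hfun]
  have h1 : ∀ i ∈ (Finset.univ : Finset (Fin k)),
      HasDerivAt (fun h : ℝ => 1 / 2 * (u i + h * v i) ^ 2) (v i * u i) 0 := by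
    intro i _
    have h2 : HasDerivAt (fun h : ℝ => u i + h * v i) (v i) 0 := by
      simpa using ((hasDerivAt_id (0 : ℝ)).mul_const (v i)).const_add (u i)
    have h3 := (h2.pow 2).const_mul (1 / 2 : ℝ)
    refine h3.congr_deriv ?_
    norm_num
    ring
  exact HasDerivAt.fun_sum h1

/-- The gradient with respect to `W₁` is `W₂ᵀ (W₂ W₁ - W₂* W₁*) x xᵀ`. -/
theorem sampleGrad₁_eq (S W : Weights p p₁ p₂) (x : EuclideanSpace ℝ (Fin p)) :
    sampleGrad₁ S W x =
      W.2ᵀ * (W.2 * W.1 - S.2 * S.1) * Matrix.vecMulVec x.ofLp x.ofLp := by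
  ext i j
  have key := hasDerivAt_half_normSq ((W.2 * W.1 - S.2 * S.1) *ᵥ x.ofLp)
    ((W.2 * Matrix.single i j (1 : ℝ)) *ᵥ x.ofLp)
  have hfun : (fun h : ℝ => sampleLoss S (W.1 + h • Matrix.single i j (1 : ℝ), W.2) x) =
      fun h : ℝ => 1 / 2 * ‖WithLp.toLp 2 ((W.2 * W.1 - S.2 * S.1) *ᵥ x.ofLp +
        h • ((W.2 * Matrix.single i j (1 : ℝ)) *ᵥ x.ofLp))‖ ^ 2 := by
    funext h
    simp only [sampleLoss, Matrix.mul_add, Matrix.mul_smul, Matrix.add_mulVec, Matrix.sub_mulVec,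
      Matrix.smul_mulVec]
    rw [sub_add_eq_add_sub]
  have hs : Matrix.single i j (1 : ℝ) *ᵥ x.ofLp = Pi.single i (x.ofLp j) := by
    rw [Matrix.single_mulVec, one_mul, Pi.single]
  simp only [sampleGrad₁, Matrix.of_apply]
  rw [hfun, key.deriv, ← Matrix.mulVec_mulVec, hs,
    dotProduct_comm, Matrix.dotProduct_mulVec, Matrix.mul_vecMulVec, Matrix.vecMulVec_apply,
    ← Matrix.mulVec_mulVec, Matrix.mulVec_transpose, dotProduct_single]

/-- The gradient with respect to `W₂` is `(W₂ W₁ - W₂* W₁*) x xᵀ W₁ᵀ`. -/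
theorem sampleGrad₂_eq (S W : Weights p p₁ p₂) (x : EuclideanSpace ℝ (Fin p)) :
    sampleGrad₂ S W x =
      (W.2 * W.1 - S.2 * S.1) * Matrix.vecMulVec x.ofLp x.ofLp * W.1ᵀ := by
  ext i j
  have key := hasDerivAt_half_normSq ((W.2 * W.1 - S.2 * S.1) *ᵥ x.ofLp)
    ((Matrix.single i j (1 : ℝ) * W.1) *ᵥ x.ofLp)
  have hfun : (fun h : ℝ => sampleLoss S (W.1, W.2 + h • Matrix.single i j (1 : ℝ)) x) =
      fun h : ℝ => 1 / 2 * ‖WithLp.toLp 2 ((W.2 * W.1 - S.2 * S.1) *ᵥ x.ofLp +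
        h • ((Matrix.single i j (1 : ℝ) * W.1) *ᵥ x.ofLp))‖ ^ 2 := by
    funext h
    simp only [sampleLoss, Matrix.add_mul, Matrix.smul_mul, Matrix.add_mulVec, Matrix.sub_mulVec,
      Matrix.smul_mulVec]
    rw [sub_add_eq_add_sub]
  have hs : Matrix.single i j (1 : ℝ) *ᵥ (W.1 *ᵥ x.ofLp) = Pi.single i ((W.1 *ᵥ x.ofLp) j) := by
    rw [Matrix.single_mulVec, one_mul, Pi.single]
  simp only [sampleGrad₂, Matrix.of_apply]
  rw [hfun, key.deriv, ← Matrix.mulVec_mulVec, hs,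
    single_dotProduct, Matrix.mul_vecMulVec, Matrix.vecMulVec_mul, Matrix.vecMulVec_apply,
    Matrix.vecMul_transpose, mul_comm]

/-- The mini-batch gradient `g₁ = (1/b) ∑ᵢ ∇_{W₁} ½ ‖W₂ W₁ xᵢ - W₂* W₁* xᵢ‖²`. -/
noncomputable def batchGrad₁ {b : ℕ} (S W : Weights p p₁ p₂)
    (x : Fin b → EuclideanSpace ℝ (Fin p)) : Matrix (Fin p₁) (Fin p) ℝ :=
  (1 / (b : ℝ)) • ∑ i, sampleGrad₁ S W (x i)

/-- The mini-batch gradient `g₂ = (1/b) ∑ᵢ ∇_{W₂} ½ ‖W₂ W₁ xᵢ - W₂* W₁* xᵢ‖²`. -/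
noncomputable def batchGrad₂ {b : ℕ} (S W : Weights p p₁ p₂)
    (x : Fin b → EuclideanSpace ℝ (Fin p)) : Matrix (Fin p₂) (Fin p₁) ℝ :=
  (1 / (b : ℝ)) • ∑ i, sampleGrad₂ S W (x i)

/-- The student weights `(W_{t,1}, W_{t,2})` after `t` steps of SGD with step sizes `α`, from the
initial weights `W₀`, where `x t` is the mini-batch drawn in step `t`. Both layers are updated
simultaneously. -/
noncomputable def sgd {b : ℕ} (α : ℕ → ℝ) (S W₀ : Weights p p₁ p₂)
    (x : ℕ → Fin b → EuclideanSpace ℝ (Fin p)) : ℕ → Weights p p₁ p₂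
  | 0 => W₀
  | t + 1 =>
    let W := sgd α S W₀ x t
    (W.1 - α t • batchGrad₁ S W (x t), W.2 - α t • batchGrad₂ S W (x t))

end Network

/-! ### The two alphabets -/

/-- Letters for the student weights `W₁, W₂` and the teacher weights `W₁*, W₂*`. -/
inductive WeightSymbol
  | student₁ | student₂ | teacher₁ | teacher₂
  deriving DecidableEq

/-- Letters for the stochastic gradients `g₁, g₂`, the student weights `W₁, W₂` and the teacher
weights `W₁*, W₂*`. -/
inductive StepSymbol
  | grad₁ | grad₂ | student₁ | student₂ | teacher₁ | teacher₂
  deriving DecidableEq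

/-- Number of rows. -/
def WeightSymbol.rows (_p p₁ p₂ : ℕ) : WeightSymbol → ℕ
  | student₁ | teacher₁ => p₁
  | student₂ | teacher₂ => p₂

/-- Number of columns. -/
def WeightSymbol.cols (p p₁ _p₂ : ℕ) : WeightSymbol → ℕ
  | student₁ | teacher₁ => p
  | student₂ | teacher₂ => p₁

/-- Number of rows. -/
def StepSymbol.rows (_p p₁ p₂ : ℕ) : StepSymbol → ℕ
  | grad₁ | student₁ | teacher₁ => p₁
  | grad₂ | student₂ | teacher₂ => p₂

/-- Number of columns. -/
def StepSymbol.cols (p p₁ _p₂ : ℕ) : StepSymbol → ℕ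
  | grad₁ | student₁ | teacher₁ => p
  | grad₂ | student₂ | teacher₂ => p₁

/-- The matrices that the letters stand for, given the student `W` and the teacher `S`. -/
def weightValue {p p₁ p₂ : ℕ} (S W : Weights p p₁ p₂) :
    (s : WeightSymbol) → Matrix (Fin (s.rows p p₁ p₂)) (Fin (s.cols p p₁ p₂)) ℝ
  | .student₁ => W.1
  | .student₂ => W.2
  | .teacher₁ => S.1
  | .teacher₂ => S.2

/-- The matrices that the letters stand for, given the student `W`, the teacher `S` and the
mini-batch `x` at which the stochastic gradients are computed. -/
noncomputable def stepValue {p p₁ p₂ b : ℕ} (S W : Weights p p₁ p₂)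
    (x : Fin b → EuclideanSpace ℝ (Fin p)) :
    (s : StepSymbol) → Matrix (Fin (s.rows p p₁ p₂)) (Fin (s.cols p p₁ p₂)) ℝ
  | .grad₁ => batchGrad₁ S W x
  | .grad₂ => batchGrad₂ S W x
  | .student₁ => W.1
  | .student₂ => W.2
  | .teacher₁ => S.1
  | .teacher₂ => S.2

/-- Trace products with parameter matrices `g₁, g₂` and constant matrices `W₁, W₂, W₁*, W₂*`. -/
abbrev StepTraceProduct (p p₁ p₂ : ℕ) : ℕ → ℕ → Type :=
  TraceProduct (StepSymbol.rows p p₁ p₂) (StepSymbol.cols p p₁ p₂)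

/-- Trace products with parameter matrices `W₁, W₂` and constant matrices `W₁*, W₂*`. -/
abbrev WeightTraceProduct (p p₁ p₂ : ℕ) : ℕ → ℕ → Type :=
  TraceProduct (WeightSymbol.rows p p₁ p₂) (WeightSymbol.cols p p₁ p₂)

/-- Total degree in the parameter matrices `g₁, g₂`. -/
def StepTraceProduct.gradDegree {p p₁ p₂ a n : ℕ} (M : StepTraceProduct p p₁ p₂ a n) : ℕ :=
  M.deg .grad₁ + M.deg .grad₂

/-- Total degree in the constant matrices `W₁, W₂`. -/
def StepTraceProduct.studentDegree {p p₁ p₂ a n : ℕ} (M : StepTraceProduct p p₁ p₂ a n) : ℕ :=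
  M.deg .student₁ + M.deg .student₂

/-- Total degree in the parameter matrices `W₁, W₂`. -/
def WeightTraceProduct.totalDegree {p p₁ p₂ a n : ℕ} (M : WeightTraceProduct p p₁ p₂ a n) : ℕ :=
  M.deg .student₁ + M.deg .student₂

/-! ### The random experiment -/

/-- The data of online SGD with mini-batch size `b`: random initial weights `W₀` (possibly
deterministic) and i.i.d. standard Gaussian samples `x t i`, independent of `W₀`. -/
structure IsOnlineSample {Ω : Type*} [MeasurableSpace Ω] (μ : Measure Ω) {p p₁ p₂ b : ℕ}
    (W₀ : Ω → Weights p p₁ p₂) (x : ℕ → Fin b → Ω → EuclideanSpace ℝ (Fin p)) : Prop where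
  measurable_init : Measurable W₀
  measurable_sample : ∀ t i, Measurable (x t i)
  law_sample : ∀ t i, μ.map (x t i) = stdGaussian (EuclideanSpace ℝ (Fin p))
  indep_sample : iIndepFun (fun ti : ℕ × Fin b => x ti.1 ti.2) μ
  indep_init : IndepFun W₀ (fun ω t i => x t i ω) μ

/-- All entries of the initial weights have finite moments of all orders (as they do when `W₀` is
deterministic). -/
def HasFiniteMoments {Ω : Type*} [MeasurableSpace Ω] (μ : Measure Ω) {p p₁ p₂ : ℕ}
    (W₀ : Ω → Weights p p₁ p₂) : Prop :=
  ∀ r : ℕ, (∀ i j, Integrable (fun ω => |(W₀ ω).1 i j| ^ r) μ) ∧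
    ∀ i j, Integrable (fun ω => |(W₀ ω).2 i j| ^ r) μ

/-- The σ-algebra `F₀` generated by the initial weights. -/
abbrev initSigma {Ω : Type*} {p p₁ p₂ : ℕ} (W₀ : Ω → Weights p p₁ p₂) : MeasurableSpace Ω :=
  MeasurableSpace.comap W₀ inferInstance

/-- The random matrix obtained from `M` by substituting the stochastic gradients `g_{t,1}, g_{t,2}`
and the student weights `W_{t,1}, W_{t,2}` of step `t` of SGD, and the teacher weights `S`. -/
noncomputable def StepTraceProduct.atStep {p p₁ p₂ a n : ℕ} (M : StepTraceProduct p p₁ p₂ a n)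
    {Ω : Type*} {b : ℕ} (α : ℕ → ℝ) (S : Weights p p₁ p₂) (W₀ : Ω → Weights p p₁ p₂)
    (x : ℕ → Fin b → Ω → EuclideanSpace ℝ (Fin p)) (t : ℕ) (ω : Ω) : Matrix (Fin a) (Fin n) ℝ :=
  M.eval (stepValue S (sgd α S (W₀ ω) (fun t' k => x t' k ω) t) (fun k => x t k ω))

/-! The mini-batch of step `t` enters the gradients only through its Gram matrix $G=\frac1b\sum_i
x_ix_i^\top$: $g_1=W_2^\top(W_2W_1-W_2^*W_1^*)G$ and $g_2=(W_2W_1-W_2^*W_1^*)GW_1^\top$. Gaussian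
integration by parts gives $\mathbb E[G_{kl}\Phi]=\delta_{kl}\mathbb E[\Phi]+\frac1b\mathbb
E[\Delta_{kl}\Phi]$ with $\Delta_{kl}=\sum_i x_{i,l}\,\partial/\partial x_{i,k}$, and
$\Delta_{kl}G=E_{kl}G+GE_{lk}$ is again linear in $G$. Contracting $k,l$ with the words around the
chosen factor $G$ only reverses segments of words and closes or opens traces (`contract_left`,
`contract_right`, `contract_trace`), so trace products stay trace products. Each use removes one $G$
at the price of at most one factor $1/b$; hence $d$ factors $G$ yield powers up to $b^{-d}$
(`exists_isGramReduction`).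

A gradient contains one $G$ and at most three student weights, so averaging over one mini-batch
leads from degrees $(d,d')$ to powers at most $d$ and student degree at most $3d+d'$
(`exists_batch_expectation`). Inserting $W_t=W_{t-1}-\alpha_{t-1}g_{t-1}$ turns each student letter
into a student or a gradient letter of the previous step. Iteration gives the factor $3^t$ and the
geometric sums $1+3+\cdots$ in the bound on $q$ (`exists_sgd_expectation`).

The expansion must not depend on $b$, on the weights or on the teacher. Words are therefore
rewritten formally, and the identities are proved for all commutative rings with suitable
derivations and functionals. The theorem uses the ring of polynomials in the sample coordinates,
with the expectation as functional (`isGaussianFunctional_polyExpectation`). Independence allows the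
initial weights to be frozen in the conditional expectation (`condExp_ae_eq_integral_of_indepFun`).
-/

/-! ### Multiplicative terms over a commutative ring -/

namespace MulTerm

variable {ι : Type} {r c : ι → ℕ} {R R' : Type*} [CommRing R] [CommRing R']

/-- The value of a multiplicative term when matrices over a commutative ring are substituted. -/
def evalIn (V : (s : ι) → Matrix (Fin (r s)) (Fin (c s)) R) :
    {a n : ℕ} → MulTerm r c a n → Matrix (Fin a) (Fin n) R
  | _, _, one _ => 1
  | _, _, mul s w => V s * w.evalIn V
  | _, _, mulT s w => (V s)ᵀ * w.evalIn V

/-- The degree of a multiplicative term when the letter `s` has degree `ν s`. -/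
def weight (ν : ι → ℕ) : {a n : ℕ} → MulTerm r c a n → ℕ
  | _, _, one _ => 0
  | _, _, mul s w => ν s + w.weight ν
  | _, _, mulT s w => ν s + w.weight ν

/-- Concatenation. -/
def append : {a m n : ℕ} → MulTerm r c a m → MulTerm r c m n → MulTerm r c a n
  | _, _, _, one _, v => v
  | _, _, _, mul s w, v => mul s (w.append v)
  | _, _, _, mulT s w, v => mulT s (w.append v)

/-- The formal transpose. -/
def transpose : {a n : ℕ} → MulTerm r c a n → MulTerm r c n a
  | _, _, one n => one n
  | _, _, mul s w => w.transpose.append (mulT s (one _))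
  | _, _, mulT s w => w.transpose.append (mul s (one _))

theorem eval_eq_evalIn (V : (s : ι) → Matrix (Fin (r s)) (Fin (c s)) ℝ) {a n : ℕ}
    (w : MulTerm r c a n) : w.eval V = w.evalIn V := by
  induction w with
  | one n => rfl
  | mul s w ih => simp [eval, evalIn, ih]
  | mulT s w ih => simp [eval, evalIn, ih]

theorem evalIn_map (f : R →+* R') (V : (s : ι) → Matrix (Fin (r s)) (Fin (c s)) R) {a n : ℕ}
    (w : MulTerm r c a n) : (w.evalIn V).map f = w.evalIn fun s => (V s).map f := by
  induction w with
  | one n => simp [evalIn]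
  | mul s w ih => simp [evalIn, Matrix.map_mul, ih]
  | mulT s w ih => simp [evalIn, Matrix.map_mul, ih, Matrix.transpose_map]

theorem evalIn_append (V : (s : ι) → Matrix (Fin (r s)) (Fin (c s)) R) {a m n : ℕ}
    (w : MulTerm r c a m) (v : MulTerm r c m n) :
    (w.append v).evalIn V = w.evalIn V * v.evalIn V := by
  induction w with
  | one n => simp [evalIn, append]
  | mul s w ih => simp [evalIn, append, ih, Matrix.mul_assoc]
  | mulT s w ih => simp [evalIn, append, ih, Matrix.mul_assoc]

theorem evalIn_transpose (V : (s : ι) → Matrix (Fin (r s)) (Fin (c s)) R) {a n : ℕ}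
    (w : MulTerm r c a n) : w.transpose.evalIn V = (w.evalIn V)ᵀ := by
  induction w with
  | one n => simp [evalIn, transpose]
  | mul s w ih => simp [evalIn, transpose, ih, evalIn_append, Matrix.transpose_mul]
  | mulT s w ih => simp [evalIn, transpose, ih, evalIn_append, Matrix.transpose_mul]

theorem weight_append (ν : ι → ℕ) {a m n : ℕ} (w : MulTerm r c a m) (v : MulTerm r c m n) :
    (w.append v).weight ν = w.weight ν + v.weight ν := by
  induction w with
  | one n => simp [weight, append]
  | mul s w ih => simp [weight, append, ih, add_assoc]
  | mulT s w ih => simp [weight, append, ih, add_assoc]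

theorem weight_transpose (ν : ι → ℕ) {a n : ℕ} (w : MulTerm r c a n) :
    w.transpose.weight ν = w.weight ν := by
  induction w with
  | one n => simp [weight, transpose]
  | mul s w ih => simp [weight, transpose, ih, weight_append, add_comm]
  | mulT s w ih => simp [weight, transpose, ih, weight_append, add_comm]

/-- All degree counts are carried out with arbitrary letter weights; this is the translation back to
the degrees of the theorem. -/
theorem weight_add [DecidableEq ι] (s t : ι) {a n : ℕ} (w : MulTerm r c a n) (k l : ℕ) :
    w.weight (fun u => k * (if u = s then 1 else 0) + l * (if u = t then 1 else 0)) =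
      k * w.deg s + l * w.deg t := by
  induction w with
  | one n => simp [weight, deg]
  | mul s w ih => simp only [weight, deg, ih]; ring
  | mulT s w ih => simp only [weight, deg, ih]; ring

/-- Entries of values lie in every subring that contains the entries of the letters. -/
theorem evalIn_mem {A : Subring R} {V : (s : ι) → Matrix (Fin (r s)) (Fin (c s)) R}
    (hV : ∀ s i j, V s i j ∈ A) {a n : ℕ} (w : MulTerm r c a n) (i : Fin a) (j : Fin n) :
    w.evalIn V i j ∈ A := by
  induction w with
  | one n =>
    simp only [evalIn, Matrix.one_apply]
    split_ifs
    exacts [A.one_mem, A.zero_mem]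
  | mul s w ih =>
    rw [evalIn, Matrix.mul_apply]
    exact A.sum_mem fun k _ => A.mul_mem (hV _ _ _) (ih _ _)
  | mulT s w ih =>
    rw [evalIn, Matrix.mul_apply]
    exact A.sum_mem fun k _ => A.mul_mem (hV _ _ _) (ih _ _)

end MulTerm

namespace TraceProduct

variable {ι : Type} {r c : ι → ℕ} {a n : ℕ} {R R' : Type*} [CommRing R] [CommRing R']

/-- The product of the values of the traces. -/
def tracesIn (V : (s : ι) → Matrix (Fin (r s)) (Fin (c s)) R)
    (ts : List (Σ k : ℕ, MulTerm r c k k)) : R :=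
  (ts.map fun T => (T.2.evalIn V).trace).prod

/-- The value of a trace product when matrices over a commutative ring are substituted. -/
def evalIn (V : (s : ι) → Matrix (Fin (r s)) (Fin (c s)) R) (M : TraceProduct r c a n) :
    Matrix (Fin a) (Fin n) R :=
  tracesIn V M.traces • M.head.evalIn V

/-- The degree of a trace product when the letter `s` has degree `ν s`. -/
def weight (ν : ι → ℕ) (M : TraceProduct r c a n) : ℕ :=
  (M.traces.map fun T => T.2.weight ν).sum + M.head.weight ν

theorem eval_eq_evalIn (V : (s : ι) → Matrix (Fin (r s)) (Fin (c s)) ℝ)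
    (M : TraceProduct r c a n) : M.eval V = M.evalIn V := by
  simp [eval, evalIn, tracesIn, MulTerm.eval_eq_evalIn]

theorem evalIn_map (f : R →+* R') (V : (s : ι) → Matrix (Fin (r s)) (Fin (c s)) R)
    (M : TraceProduct r c a n) : (M.evalIn V).map f = M.evalIn fun s => (V s).map f := by
  have h : f (tracesIn V M.traces) = tracesIn (fun s => (V s).map f) M.traces := by
    simp only [tracesIn, map_list_prod, List.map_map]
    congr 2
    funext T
    simp [← MulTerm.evalIn_map, AddMonoidHom.map_trace]
  ext i j
  simp [evalIn, h, ← MulTerm.evalIn_map]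

theorem weight_add [DecidableEq ι] (s t : ι) (M : TraceProduct r c a n) (k l : ℕ) :
    M.weight (fun u => k * (if u = s then 1 else 0) + l * (if u = t then 1 else 0)) =
      k * M.deg s + l * M.deg t := by
  simp only [weight, deg, MulTerm.weight_add, List.sum_map_add, List.sum_map_mul_left]
  ring

theorem evalIn_mem {A : Subring R} {V : (s : ι) → Matrix (Fin (r s)) (Fin (c s)) R}
    (hV : ∀ s i j, V s i j ∈ A) (M : TraceProduct r c a n) (i : Fin a) (j : Fin n) :
    M.evalIn V i j ∈ A := by
  refine A.mul_mem (A.list_prod_mem fun x hx => ?_) (M.head.evalIn_mem hV i j)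
  obtain ⟨T, -, rfl⟩ := List.mem_map.1 hx
  exact A.sum_mem fun k _ => T.2.evalIn_mem hV k k

end TraceProduct

/-! ### Eliminating a Gram matrix by integration by parts -/

section GramMatrix

variable {ι : Type} {r c : ι → ℕ} {R : Type*} [CommRing R] {p : ℕ}

/-- Sizes of the letters when a letter `none` of size `p` is added to the alphabet. -/
def extSize (p : ℕ) (r : ι → ℕ) : Option ι → ℕ
  | none => p
  | some s => r s

/-- The values of the letters when the letter `none` stands for `G`. -/
def extValue (G : Matrix (Fin p) (Fin p) R) (V : (s : ι) → Matrix (Fin (r s)) (Fin (c s)) R) :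
    (s : Option ι) → Matrix (Fin (extSize p r s)) (Fin (extSize p c s)) R
  | none => G
  | some s => V s

namespace MulTerm

/-- Multiplication by the added letter. -/
def gram {n : ℕ} (w : MulTerm (extSize p r) (extSize p c) p n) :
    MulTerm (extSize p r) (extSize p c) p n :=
  mul (none : Option ι) w

/-- Multiplication by the transpose of the added letter. -/
def gramT {n : ℕ} (w : MulTerm (extSize p r) (extSize p c) p n) :
    MulTerm (extSize p r) (extSize p c) p n :=
  mulT (none : Option ι) w

/-- Multiplication by an original letter. -/
def old {n : ℕ} (s : ι) (w : MulTerm (extSize p r) (extSize p c) (c s) n) :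
    MulTerm (extSize p r) (extSize p c) (r s) n :=
  mul (some s) w

/-- Multiplication by the transpose of an original letter. -/
def oldT {n : ℕ} (s : ι) (w : MulTerm (extSize p r) (extSize p c) (r s) n) :
    MulTerm (extSize p r) (extSize p c) (c s) n :=
  mulT (some s) w

-- `extSize` reduces only on `none` and `some s`. Separating the four kinds of letters once gives
-- later inductions the plain sizes `p`, `r s` and `c s`.
@[elab_as_elim]
theorem ext_induction
    {motive : ∀ {a n : ℕ}, MulTerm (extSize p r) (extSize p c) a n → Prop}
    (one : ∀ n, motive (one n))
    (gram : ∀ {n} (w : MulTerm (extSize p r) (extSize p c) p n), motive w → motive w.gram)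
    (gramT : ∀ {n} (w : MulTerm (extSize p r) (extSize p c) p n), motive w → motive w.gramT)
    (old : ∀ {n} s (w : MulTerm (extSize p r) (extSize p c) (c s) n),
      motive w → motive (w.old s))
    (oldT : ∀ {n} s (w : MulTerm (extSize p r) (extSize p c) (r s) n),
      motive w → motive (w.oldT s))
    {a n : ℕ} (w : MulTerm (extSize p r) (extSize p c) a n) : motive w := by
  induction w with
  | one n => exact one n
  | mul s w ih =>
    cases s with
    | none => exact gram w ih
    | some s => exact old s w ih
  | mulT s w ih =>
    cases s with
    | none => exact gramT w ih
    | some s => exact oldT s w ih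

/-- All ways of writing a word as `P G Q`, where `G` is the added letter or its transpose. -/
def splits : {a n : ℕ} → MulTerm (extSize p r) (extSize p c) a n →
    List (MulTerm (extSize p r) (extSize p c) a p × MulTerm (extSize p r) (extSize p c) p n)
  | _, _, one _ => []
  | _, _, mul none w => (one p, w) :: w.splits.map fun s => (gram s.1, s.2)
  | _, _, mulT none w => (one p, w) :: w.splits.map fun s => (gram s.1, s.2)
  | _, _, mul (some u) w => w.splits.map fun s => (old u s.1, s.2)
  | _, _, mulT (some u) w => w.splits.map fun s => (oldT u s.1, s.2)

section

variable {n : ℕ} (w : MulTerm (extSize p r) (extSize p c) p n)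

theorem splits_gram : w.gram.splits = (one p, w) :: w.splits.map fun s => (gram s.1, s.2) := rfl

theorem splits_gramT : w.gramT.splits = (one p, w) :: w.splits.map fun s => (gram s.1, s.2) := rfl

theorem splits_old (u : ι) (w : MulTerm (extSize p r) (extSize p c) (c u) n) :
    (w.old u).splits = w.splits.map fun s => (old u s.1, s.2) := rfl

theorem splits_oldT (u : ι) (w : MulTerm (extSize p r) (extSize p c) (r u) n) :
    (w.oldT u).splits = w.splits.map fun s => (oldT u s.1, s.2) := rfl

variable (ν : Option ι → ℕ)

theorem weight_gram : w.gram.weight ν = ν none + w.weight ν := rfl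

theorem weight_gramT : w.gramT.weight ν = ν none + w.weight ν := rfl

theorem weight_old (u : ι) (w : MulTerm (extSize p r) (extSize p c) (c u) n) :
    (w.old u).weight ν = ν (some u) + w.weight ν := rfl

theorem weight_oldT (u : ι) (w : MulTerm (extSize p r) (extSize p c) (r u) n) :
    (w.oldT u).weight ν = ν (some u) + w.weight ν := rfl

variable (G : Matrix (Fin p) (Fin p) R) (V : (s : ι) → Matrix (Fin (r s)) (Fin (c s)) R)

theorem evalIn_gram :
    w.gram.evalIn (extValue G V) = G * w.evalIn (extValue G V) := rfl

theorem evalIn_gramT :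
    w.gramT.evalIn (extValue G V) = Gᵀ * w.evalIn (extValue G V) := rfl

theorem evalIn_old (u : ι) (w : MulTerm (extSize p r) (extSize p c) (c u) n) :
    (w.old u).evalIn (extValue G V) = V u * w.evalIn (extValue G V) := rfl

theorem evalIn_oldT (u : ι) (w : MulTerm (extSize p r) (extSize p c) (r u) n) :
    (w.oldT u).evalIn (extValue G V) = (V u)ᵀ * w.evalIn (extValue G V) := rfl

theorem evalIn_one : (one n : MulTerm (extSize p r) (extSize p c) n n).evalIn (extValue G V) = 1 :=
  rfl

end

/-- Cutting out an occurrence of the added letter costs exactly its weight. With `gramDegree` this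
counts the remaining factors $G$. -/
theorem weight_of_mem_splits (ν : Option ι → ℕ) {a n : ℕ}
    (w : MulTerm (extSize p r) (extSize p c) a n) :
    ∀ s ∈ w.splits, s.1.weight ν + s.2.weight ν + ν none = w.weight ν := by
  induction w using ext_induction with
  | one n => simp [splits]
  | gram w ih | gramT w ih =>
    intro s hs
    simp only [splits_gram, splits_gramT, List.mem_cons, List.mem_map] at hs
    rcases hs with rfl | ⟨u, hu, rfl⟩
    · simp [weight, weight_gram, weight_gramT, add_comm]
    · simp only [weight_gram, weight_gramT, ← ih u hu]
      ring
  | old t w ih | oldT t w ih =>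
    intro s hs
    simp only [splits_old, splits_oldT, List.mem_map] at hs
    obtain ⟨u, hu, rfl⟩ := hs
    simp only [weight_old, weight_oldT, ← ih u hu]
    ring

/-- Symmetry of $G$ is essential: `splits` does not record whether the removed letter was
transposed. -/
theorem evalIn_of_mem_splits {G : Matrix (Fin p) (Fin p) R} (hG : Gᵀ = G)
    (V : (s : ι) → Matrix (Fin (r s)) (Fin (c s)) R) {a n : ℕ}
    (w : MulTerm (extSize p r) (extSize p c) a n) :
    ∀ s ∈ w.splits, w.evalIn (extValue G V) =
      s.1.evalIn (extValue G V) * G * s.2.evalIn (extValue G V) := by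
  induction w using ext_induction with
  | one n => simp [splits]
  | gram w ih | gramT w ih =>
    intro s hs
    simp only [splits_gram, splits_gramT, List.mem_cons, List.mem_map] at hs
    rcases hs with rfl | ⟨u, hu, rfl⟩
    · simp [evalIn_gram, evalIn_gramT, evalIn_one, hG]
    · simp only [evalIn_gram, evalIn_gramT, ih u hu, hG, Matrix.mul_assoc]
  | old t w ih | oldT t w ih =>
    intro s hs
    simp only [splits_old, splits_oldT, List.mem_map] at hs
    obtain ⟨u, hu, rfl⟩ := hs
    simp only [evalIn_old, evalIn_oldT, ih u hu, Matrix.mul_assoc]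

/-- A word without the added letter is a word over the original alphabet. -/
theorem exists_of_splits_eq_nil {a n : ℕ} (w : MulTerm (extSize p r) (extSize p c) a n)
    (hw : w.splits = []) : ∃ v : MulTerm r c a n,
      (∀ ν : Option ι → ℕ, v.weight (fun s => ν (some s)) = w.weight ν) ∧
      ∀ (R : Type) [CommRing R] (G : Matrix (Fin p) (Fin p) R)
        (V : (s : ι) → Matrix (Fin (r s)) (Fin (c s)) R),
        w.evalIn (extValue G V) = v.evalIn V := by
  induction w using ext_induction with
  | one n => exact ⟨one n, fun _ => rfl, fun _ _ _ _ => rfl⟩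
  | gram w ih => simp [splits_gram] at hw
  | gramT w ih => simp [splits_gramT] at hw
  | old u w ih =>
    obtain ⟨v, hv, hv'⟩ := ih (by simpa [splits_old] using hw)
    exact ⟨mul u v, fun ν => by rw [weight, weight_old, hv],
      fun R _ G V => by rw [evalIn, evalIn_old, hv']⟩
  | oldT u w ih =>
    obtain ⟨v, hv, hv'⟩ := ih (by simpa [splits_oldT] using hw)
    exact ⟨mulT u v, fun ν => by rw [weight, weight_oldT, hv],
      fun R _ G V => by rw [evalIn, evalIn_oldT, hv']⟩

end MulTerm

/-- The direction `Eₖₗ G + G Eₗₖ`. -/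
def gramTangent (G : Matrix (Fin p) (Fin p) R) (k l : Fin p) : Matrix (Fin p) (Fin p) R :=
  Matrix.single k l 1 * G + G * Matrix.single l k 1

/-- Derivations `Δ k l` that act on the symmetric matrix `G` as `G ↦ Eₖₗ G + G Eₗₖ`. -/
structure IsGramDerivation [Algebra ℝ R] (G : Matrix (Fin p) (Fin p) R)
    (Δ : Fin p → Fin p → Derivation ℝ R R) : Prop where
  symm : Gᵀ = G
  apply_gram : ∀ k l,
    G.map (Δ k l) = gramTangent G k l

/-- Functionals that satisfy the integration by parts formula of a Wishart matrix `G`. -/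
def IsGramFunctional [Algebra ℝ R] (β : ℝ) (G : Matrix (Fin p) (Fin p) R)
    (Δ : Fin p → Fin p → Derivation ℝ R R) (E : R →ₗ[ℝ] ℝ) : Prop :=
  ∀ k l Φ, E (G k l * Φ) = (if k = l then E Φ else 0) + β * E (Δ k l Φ)

theorem Matrix.map_derivation_mul [Algebra ℝ R] (D : Derivation ℝ R R) {a m n : ℕ}
    (A : Matrix (Fin a) (Fin m) R) (B : Matrix (Fin m) (Fin n) R) :
    (A * B).map D = A.map D * B + A * B.map D := by
  ext i j
  simp only [Matrix.map_apply, Matrix.mul_apply, map_sum, Derivation.leibniz, Matrix.add_apply,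
    ← Finset.sum_add_distrib, smul_eq_mul]
  exact Finset.sum_congr rfl fun k _ => by ring

variable [Algebra ℝ R] {G : Matrix (Fin p) (Fin p) R} {Δ : Fin p → Fin p → Derivation ℝ R R}
  {V : (s : ι) → Matrix (Fin (r s)) (Fin (c s)) R}

/-- The product rule: one summand for each occurrence of $G$ or $G^\top$, the original letters being
constants for `Δ`. -/
theorem IsGramDerivation.map_evalIn (h : IsGramDerivation G Δ)
    (hV : ∀ s i j k l, Δ k l (V s i j) = 0) (k l : Fin p) {a n : ℕ}
    (w : MulTerm (extSize p r) (extSize p c) a n) :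
    (w.evalIn (extValue G V)).map (Δ k l) = (w.splits.map fun s =>
      s.1.evalIn (extValue G V) * gramTangent G k l *
        s.2.evalIn (extValue G V)).sum := by
  have hV' : ∀ s, (V s).map (Δ k l) = 0 := fun s => by ext i j; exact hV s i j k l
  have hV'' : ∀ s, (V s)ᵀ.map (Δ k l) = 0 := fun s => by ext i j; exact hV s j i k l
  have hone : ∀ n, (1 : Matrix (Fin n) (Fin n) R).map (Δ k l) = 0 := fun n => by
    ext i j
    simp only [Matrix.map_apply, Matrix.one_apply, Matrix.zero_apply]
    split_ifs <;> simp
  have hsum : ∀ {a m n : ℕ} (A : Matrix (Fin a) (Fin m) R) (L : List (Matrix (Fin m) (Fin n) R)),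
      A * L.sum = (L.map fun B => A * B).sum := fun A L => by
    induction L with
    | nil => simp
    | cons B L ih => simp [Matrix.mul_add, ih]
  induction w using MulTerm.ext_induction with
  | one n => simp [MulTerm.evalIn, MulTerm.splits, hone]
  | gram w ih | gramT w ih =>
    simp only [MulTerm.evalIn_gram, MulTerm.evalIn_gramT, MulTerm.splits_gram,
      MulTerm.splits_gramT, h.symm, Matrix.map_derivation_mul, h.apply_gram, ih, hsum,
      List.map_map, List.map_cons, List.sum_cons, Function.comp_def, Matrix.mul_assoc,
      MulTerm.evalIn_one, Matrix.one_mul]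
  | old u w ih | oldT u w ih =>
    simp only [MulTerm.evalIn_old, MulTerm.evalIn_oldT, MulTerm.splits_old, MulTerm.splits_oldT,
      Matrix.map_derivation_mul, ih, hsum, hV', hV'', List.map_map, Function.comp_def,
      Matrix.mul_assoc, Matrix.zero_mul, zero_add]

end GramMatrix

/-! ### Index contractions against the tangent direction $E_{kl}G+GE_{lk}$. -/

section Contractions

variable {R : Type*} [CommRing R] {p a n : ℕ}

theorem Matrix.mul_single_mul_apply {a m m' n : ℕ} (P : Matrix (Fin a) (Fin m) R)
    (Q : Matrix (Fin m') (Fin n) R) (k : Fin m) (l : Fin m') (i : Fin a) (j : Fin n) :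
    (P * Matrix.single k l (1 : R) * Q) i j = P i k * Q l j := by
  rw [Matrix.mul_apply, Finset.sum_eq_single l]
  · simp
  · intro b _ hb
    simp [Matrix.mul_single_apply_of_ne, hb]
  · simp

theorem mul_gramTangent_mul_apply (G : Matrix (Fin p) (Fin p) R) (P : Matrix (Fin a) (Fin p) R)
    (Q : Matrix (Fin p) (Fin n) R) (k l : Fin p) (i : Fin a) (j : Fin n) :
    (P * gramTangent G k l * Q) i j =
      P i k * (G * Q) l j + (P * G) i l * Q k j := by
  rw [← Matrix.mul_single_mul_apply, ← Matrix.mul_single_mul_apply, ← Matrix.add_apply]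
  simp only [gramTangent, Matrix.mul_add, Matrix.add_mul, Matrix.mul_assoc]

theorem sum_sum_mul_mul_apply {m m' : ℕ} (A : Matrix (Fin a) (Fin m) R)
    (B : Matrix (Fin m) (Fin m') R) (C : Matrix (Fin m') (Fin n) R) (i : Fin a) (j : Fin n) :
    ∑ k, ∑ l, A i k * B k l * C l j = (A * B * C) i j := by
  simp only [Matrix.mul_apply, Finset.sum_mul]
  exact Finset.sum_comm

/-- The case where the derivative falls to the right of the removed $G$. The part $E_{kl}G$ joins
`A` to the reversed word `P`; the part $GE_{lk}$ closes $PG$ into a new trace. -/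
theorem contract_right {G : Matrix (Fin p) (Fin p) R} (A : Matrix (Fin a) (Fin p) R)
    (P : Matrix (Fin p) (Fin p) R) (Q : Matrix (Fin p) (Fin n) R) (i : Fin a) (j : Fin n) :
    ∑ k, ∑ l, A i k * (P * gramTangent G k l * Q) l j =
      (A * (Pᵀ * (G * Q))) i j + ((P * G).trace • (A * Q)) i j := by
  simp only [mul_gramTangent_mul_apply, mul_add, Finset.sum_add_distrib]
  congr 1
  · rw [← Matrix.mul_assoc, ← sum_sum_mul_mul_apply]
    simp [mul_assoc]
  · simp only [Matrix.smul_apply, smul_eq_mul, Matrix.trace, Matrix.mul_apply (M := A) (N := Q),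
      Finset.mul_sum, Finset.sum_mul, Matrix.diag_apply]
    exact Finset.sum_congr rfl fun k _ => Finset.sum_congr rfl fun l _ => by ring

/-- The mirror case, with the derivative to the left of the removed $G$: $E_{kl}G$ reverses `Q`, and
$GE_{lk}$ closes `Q` into a new trace. -/
theorem contract_left {G : Matrix (Fin p) (Fin p) R} (hG : Gᵀ = G) (B : Matrix (Fin p) (Fin n) R)
    (P : Matrix (Fin a) (Fin p) R) (Q : Matrix (Fin p) (Fin p) R) (i : Fin a) (j : Fin n) :
    ∑ k, ∑ l, (P * gramTangent G k l * Q) i k * B l j =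
      (P * (Qᵀ * (G * B))) i j + (Q.trace • (P * (G * B))) i j := by
  simp only [mul_gramTangent_mul_apply, add_mul, Finset.sum_add_distrib]
  congr 1
  · rw [← Matrix.mul_assoc Qᵀ, ← Matrix.mul_assoc, ← hG, ← Matrix.transpose_mul, hG,
      ← sum_sum_mul_mul_apply]
    simp
  · simp only [Matrix.smul_apply, smul_eq_mul, Matrix.trace, ← Matrix.mul_assoc,
      Matrix.mul_apply (M := P * G) (N := B), Finset.mul_sum, Finset.sum_mul, Matrix.diag_apply]
    rw [Finset.sum_comm]
    exact Finset.sum_congr rfl fun k _ => Finset.sum_congr rfl fun l _ => by ring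

/-- The derivative falls on a trace. Both parts cut that trace open and insert its cyclic word, once
reversed and once not, between `A` and `B`. -/
theorem contract_trace {G : Matrix (Fin p) (Fin p) R} (hG : Gᵀ = G) {m : ℕ}
    (A : Matrix (Fin a) (Fin p) R) (B : Matrix (Fin p) (Fin n) R)
    (P : Matrix (Fin m) (Fin p) R) (Q : Matrix (Fin p) (Fin m) R) (i : Fin a) (j : Fin n) :
    ∑ k, ∑ l, A i k *
        (P * gramTangent G k l * Q).trace * B l j =
      (A * (Pᵀ * (Qᵀ * (G * B)))) i j + (A * (Q * (P * (G * B)))) i j := by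
  have h : ∀ k l, (P * gramTangent G k l * Q).trace =
      ((G * Q * P)ᵀ + Q * P * G) k l := fun k l => by
    simp only [Matrix.trace, Matrix.diag_apply, mul_gramTangent_mul_apply,
      Finset.sum_add_distrib, Matrix.add_apply, Matrix.transpose_apply, Matrix.mul_assoc Q P,
      Matrix.mul_apply (M := G * Q) (N := P), Matrix.mul_apply (M := Q) (N := P * G)]
    congr 1 <;> exact Finset.sum_congr rfl fun x _ => mul_comm _ _
  simp only [h, sum_sum_mul_mul_apply]
  rw [Matrix.mul_add, Matrix.add_mul, Matrix.add_apply]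
  simp only [Matrix.transpose_mul, hG, Matrix.mul_assoc]

end Contractions

/-! ### Sums over lists and the product rule for list products. -/

section Lists

theorem Finset.sum_list_sum_map {α β M : Type*} [AddCommMonoid M] (s : Finset α) (L : List β)
    (f : α → β → M) : ∑ k ∈ s, (L.map (f k)).sum = (L.map fun x => ∑ k ∈ s, f k x).sum := by
  induction L with
  | nil => simp
  | cons x L ih => simp [Finset.sum_add_distrib, ih]

theorem Matrix.list_sum_map_apply {β M m n : Type*} [AddCommMonoid M] (L : List β)
    (f : β → Matrix m n M) (i : m) (j : n) :
    (L.map f).sum i j = (L.map fun x => f x i j).sum := by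
  induction L with
  | nil => simp
  | cons x L ih => simp [ih]

theorem List.sum_flatMap_map {α β M : Type*} [AddMonoid M] (L : List α) (f : α → List β)
    (g : β → M) : ((L.flatMap f).map g).sum = (L.map fun x => ((f x).map g).sum).sum := by
  induction L with
  | nil => simp
  | cons x L ih => simp [ih]

/-- All ways of selecting one element from a list. -/
def List.picks {α : Type*} : List α → List (α × List α)
  | [] => []
  | x :: L => (x, L) :: L.picks.map fun u => (u.1, x :: u.2)

theorem List.perm_of_mem_picks {α : Type*} {L : List α} :
    ∀ u ∈ L.picks, (u.1 :: u.2).Perm L := by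
  induction L with
  | nil => simp [List.picks]
  | cons x L ih =>
    intro u hu
    simp only [List.picks, List.mem_cons, List.mem_map] at hu
    rcases hu with rfl | ⟨v, hv, rfl⟩
    · exact List.Perm.refl _
    · exact (List.Perm.swap _ _ _).trans ((ih v hv).cons x)

theorem Derivation.list_prod_map {R α : Type*} [CommRing R] [Algebra ℝ R] (D : Derivation ℝ R R)
    (f : α → R) (L : List α) :
    D (L.map f).prod = (L.picks.map fun u => D (f u.1) * (u.2.map f).prod).sum := by
  induction L with
  | nil => simp [List.picks]
  | cons x L ih =>
    simp only [List.picks, List.map_cons, List.prod_cons, Derivation.leibniz, smul_eq_mul, ih,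
      List.sum_cons, List.map_map, Function.comp_def, ← List.sum_map_mul_left]
    rw [add_comm, mul_comm]
    congr 3
    funext u
    ring

end Lists

/-! ### One integration by parts on a trace product. -/

section GramElimination

variable {ι : Type} {r c : ι → ℕ} {p a n : ℕ}

/-- The trace products that appear when one factor `G` of `∏ tr(ts) A G B` is integrated by parts
against the others. -/
def steinTerms (A : MulTerm (extSize p r) (extSize p c) a p)
    (B : MulTerm (extSize p r) (extSize p c) p n)
    (ts : List (Σ k : ℕ, MulTerm (extSize p r) (extSize p c) k k)) :
    List (TraceProduct (extSize p r) (extSize p c) a n) :=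
  (A.splits.flatMap fun s =>
    [⟨ts, s.1.append (s.2.transpose.append B.gram)⟩, ⟨⟨p, s.2⟩ :: ts, s.1.append B.gram⟩]) ++
  (B.splits.flatMap fun s =>
    [⟨ts, A.append (s.1.transpose.append s.2.gram)⟩,
      ⟨⟨p, s.1.append (MulTerm.one p).gram⟩ :: ts, A.append s.2⟩]) ++
  ts.picks.flatMap fun u => u.1.2.splits.flatMap fun s =>
    [⟨u.2, A.append (s.1.transpose.append (s.2.transpose.append B.gram))⟩,
      ⟨u.2, A.append (s.2.append (s.1.append B.gram))⟩]

/-- Every term regains in the tangent the $G$ that its split cut out. Compared with `∏ tr(ts) A G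
B`, exactly the one integrated factor $G$ is missing. -/
theorem weight_of_mem_steinTerms (ν : Option ι → ℕ)
    (A : MulTerm (extSize p r) (extSize p c) a p)
    (B : MulTerm (extSize p r) (extSize p c) p n)
    (ts : List (Σ k : ℕ, MulTerm (extSize p r) (extSize p c) k k)) :
    ∀ T ∈ steinTerms A B ts,
      T.weight ν = A.weight ν + B.weight ν + (ts.map fun T => T.2.weight ν).sum := by
  intro T hT
  simp only [steinTerms, List.mem_append, List.mem_flatMap, List.mem_cons, List.not_mem_nil,
    or_false] at hT
  rcases hT with (⟨s, hs, rfl | rfl⟩ | ⟨s, hs, rfl | rfl⟩) | ⟨u, hu, s, hs, rfl | rfl⟩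
  iterate 4
    simp only [TraceProduct.weight, MulTerm.weight_append, MulTerm.weight_transpose,
      MulTerm.weight_gram, List.map_cons, List.sum_cons, MulTerm.weight,
      ← MulTerm.weight_of_mem_splits ν _ s hs]
    ring
  all_goals
    have h := ((List.perm_of_mem_picks u hu).map fun T => T.2.weight ν).sum_eq
    simp only [List.map_cons, List.sum_cons] at h
    simp only [TraceProduct.weight, MulTerm.weight_append, MulTerm.weight_transpose,
      MulTerm.weight_gram, ← h, ← MulTerm.weight_of_mem_splits ν _ s hs]
    ring

section

variable {R : Type*} [CommRing R] [Algebra ℝ R] {G : Matrix (Fin p) (Fin p) R}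
  {Δ : Fin p → Fin p → Derivation ℝ R R} {V : (s : ι) → Matrix (Fin (r s)) (Fin (c s)) R}

theorem IsGramDerivation.apply_evalIn (h : IsGramDerivation G Δ)
    (hV : ∀ s i j k l, Δ k l (V s i j) = 0) (k l : Fin p) {a n : ℕ}
    (w : MulTerm (extSize p r) (extSize p c) a n) (i : Fin a) (j : Fin n) :
    Δ k l (w.evalIn (extValue G V) i j) = (w.splits.map fun s =>
      (s.1.evalIn (extValue G V) * gramTangent G k l * s.2.evalIn (extValue G V)) i j).sum := by
  rw [← Matrix.list_sum_map_apply, ← h.map_evalIn hV, Matrix.map_apply]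

theorem IsGramDerivation.apply_trace_evalIn (h : IsGramDerivation G Δ)
    (hV : ∀ s i j k l, Δ k l (V s i j) = 0) (k l : Fin p) {a : ℕ}
    (w : MulTerm (extSize p r) (extSize p c) a a) :
    Δ k l (w.evalIn (extValue G V)).trace = (w.splits.map fun s =>
      (s.1.evalIn (extValue G V) * gramTangent G k l * s.2.evalIn (extValue G V)).trace).sum := by
  simp only [Matrix.trace, Matrix.diag_apply, map_sum, h.apply_evalIn hV, Finset.sum_list_sum_map]

/-- The three blocks of `steinTerms` correspond to the derivative falling on `A`, on `B` or on one
of the traces, each evaluated by its contraction lemma. -/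
theorem IsGramDerivation.sum_sum_apply (h : IsGramDerivation G Δ)
    (hV : ∀ s i j k l, Δ k l (V s i j) = 0)
    (A : MulTerm (extSize p r) (extSize p c) a p)
    (B : MulTerm (extSize p r) (extSize p c) p n)
    (ts : List (Σ k : ℕ, MulTerm (extSize p r) (extSize p c) k k)) (i : Fin a) (j : Fin n) :
    ∑ k, ∑ l, Δ k l (A.evalIn (extValue G V) i k * B.evalIn (extValue G V) l j *
        TraceProduct.tracesIn (extValue G V) ts) =
      ((steinTerms A B ts).map fun T => T.evalIn (extValue G V) i j).sum := by
  set W := extValue G V with hW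
  have h1 : ∑ k, ∑ l, Δ k l (A.evalIn W i k) * B.evalIn W l j =
      (A.splits.map fun s =>
        (s.1.evalIn W * ((s.2.evalIn W)ᵀ * (G * B.evalIn W))) i j +
          ((s.2.evalIn W).trace • (s.1.evalIn W * (G * B.evalIn W))) i j).sum := by
    simp only [hW, h.apply_evalIn hV, ← List.sum_map_mul_right, Finset.sum_list_sum_map,
      contract_left h.symm]
  have h2 : ∑ k, ∑ l, A.evalIn W i k * Δ k l (B.evalIn W l j) =
      (B.splits.map fun s =>
        (A.evalIn W * ((s.1.evalIn W)ᵀ * (G * s.2.evalIn W))) i j +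
          ((s.1.evalIn W * G).trace • (A.evalIn W * s.2.evalIn W)) i j).sum := by
    simp only [hW, h.apply_evalIn hV, ← List.sum_map_mul_left, Finset.sum_list_sum_map,
      contract_right]
  have h3 : ∀ {m : ℕ} (w : MulTerm (extSize p r) (extSize p c) m m),
      ∑ k, ∑ l, A.evalIn W i k * Δ k l (w.evalIn W).trace * B.evalIn W l j =
      (w.splits.map fun s =>
        (A.evalIn W * ((s.1.evalIn W)ᵀ * ((s.2.evalIn W)ᵀ * (G * B.evalIn W)))) i j +
          (A.evalIn W * (s.2.evalIn W * (s.1.evalIn W * (G * B.evalIn W)))) i j).sum := by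
    intro m w
    simp only [hW, h.apply_trace_evalIn hV, ← List.sum_map_mul_left, ← List.sum_map_mul_right,
      Finset.sum_list_sum_map, contract_trace h.symm]
  have h4 : ∑ k, ∑ l, A.evalIn W i k * Δ k l (TraceProduct.tracesIn W ts) * B.evalIn W l j =
      (ts.picks.map fun u => TraceProduct.tracesIn W u.2 *
        ∑ k, ∑ l, A.evalIn W i k * Δ k l (u.1.2.evalIn W).trace * B.evalIn W l j).sum := by
    rw [TraceProduct.tracesIn]
    simp only [Derivation.list_prod_map, ← List.sum_map_mul_left, ← List.sum_map_mul_right,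
      Finset.sum_list_sum_map, Finset.mul_sum]
    congr 2
    funext u
    refine Finset.sum_congr rfl fun k _ => Finset.sum_congr rfl fun l _ => ?_
    rw [TraceProduct.tracesIn]
    ring
  have h5 : ∀ k l, Δ k l (A.evalIn W i k * B.evalIn W l j * TraceProduct.tracesIn W ts) =
      TraceProduct.tracesIn W ts * (Δ k l (A.evalIn W i k) * B.evalIn W l j) +
      TraceProduct.tracesIn W ts * (A.evalIn W i k * Δ k l (B.evalIn W l j)) +
      A.evalIn W i k * Δ k l (TraceProduct.tracesIn W ts) * B.evalIn W l j := by
    intro k l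
    simp only [Derivation.leibniz, smul_eq_mul]
    ring
  have h6 : ∑ k, ∑ l, Δ k l (A.evalIn W i k * B.evalIn W l j * TraceProduct.tracesIn W ts) =
      TraceProduct.tracesIn W ts * (∑ k, ∑ l, Δ k l (A.evalIn W i k) * B.evalIn W l j) +
      TraceProduct.tracesIn W ts * (∑ k, ∑ l, A.evalIn W i k * Δ k l (B.evalIn W l j)) +
      ∑ k, ∑ l, A.evalIn W i k * Δ k l (TraceProduct.tracesIn W ts) * B.evalIn W l j := by
    simp only [h5, Finset.sum_add_distrib, Finset.mul_sum]
  rw [h6]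
  simp only [h1, h2, h4, h3, steinTerms,
    List.map_append, List.sum_append, List.sum_flatMap_map, List.map_cons, List.map_nil,
    List.sum_cons, List.sum_nil, add_zero, TraceProduct.evalIn, Matrix.smul_apply, smul_eq_mul,
    MulTerm.evalIn_append, MulTerm.evalIn_transpose, ← List.sum_map_mul_left, mul_add]
  simp only [hW, MulTerm.evalIn_gram, TraceProduct.tracesIn, List.map_cons, List.prod_cons,
    MulTerm.evalIn_append, MulTerm.evalIn_one, Matrix.mul_one]
  congr 4
  · funext s
    ring
  · funext s
    ring

/-- The chosen factor is expanded as $\sum_{k,l}A_{ik}G_{kl}B_{lj}$ and each $G_{kl}$ is integrated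
by parts. The $\delta_{kl}$ term glues the two pieces of the head together; the derivative term
gives `steinTerms`. -/
theorem IsGramFunctional.apply_evalIn {β : ℝ} {E : R →ₗ[ℝ] ℝ} (h : IsGramDerivation G Δ)
    (hE : IsGramFunctional β G Δ E) (hV : ∀ s i j k l, Δ k l (V s i j) = 0)
    (M : TraceProduct (extSize p r) (extSize p c) a n) {s} (hs : s ∈ M.head.splits)
    (i : Fin a) (j : Fin n) :
    E (M.evalIn (extValue G V) i j) =
      E ((⟨M.traces, s.1.append s.2⟩ : TraceProduct _ _ a n).evalIn (extValue G V) i j) +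
        β * ((steinTerms s.1 s.2 M.traces).map fun T => E (T.evalIn (extValue G V) i j)).sum := by
  have hsum : ((steinTerms s.1 s.2 M.traces).map fun T => E (T.evalIn (extValue G V) i j)).sum =
      E ((steinTerms s.1 s.2 M.traces).map fun T => T.evalIn (extValue G V) i j).sum := by
    rw [map_list_sum, List.map_map]
    rfl
  have hM : M.evalIn (extValue G V) i j = ∑ k, ∑ l, G k l *
      (s.1.evalIn (extValue G V) i k * s.2.evalIn (extValue G V) l j *
        TraceProduct.tracesIn (extValue G V) M.traces) := by
    rw [TraceProduct.evalIn, MulTerm.evalIn_of_mem_splits h.symm V M.head s hs,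
      Matrix.smul_apply, ← sum_sum_mul_mul_apply]
    simp only [smul_eq_mul, Finset.mul_sum]
    exact Finset.sum_congr rfl fun k _ => Finset.sum_congr rfl fun l _ => by ring
  have hE' : ∀ k l Φ, E (G k l * Φ) = (if k = l then E Φ else 0) + β * E (Δ k l Φ) := hE
  rw [hsum, ← h.sum_sum_apply hV, hM]
  simp only [map_sum, hE', Finset.sum_add_distrib, Finset.mul_sum]
  congr 1
  simp only [Finset.sum_ite_eq, Finset.mem_univ, if_true]
  rw [← map_sum]
  congr 1
  rw [TraceProduct.evalIn, MulTerm.evalIn_append, Matrix.smul_apply, Matrix.mul_apply,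
    smul_eq_mul, Finset.mul_sum]
  exact Finset.sum_congr rfl fun k _ => by ring

end

end GramElimination

/-! ### Elimination of all Gram factors. -/

section GramElimination

variable {ι : Type} {r c : ι → ℕ} {p a n : ℕ}

/-- The degree in the added letter. -/
def gramDegree : Option ι → ℕ
  | none => 1
  | some _ => 0

/-- `N` is a list of trace products over the alphabet `r', c'` such that `β^k` times its
expectations add up to the expectation of `M`, for all functionals that satisfy the integration by
parts formula of the Gram matrix. -/
def IsGramReduction {κ : Type} {r' c' : κ → ℕ}
    (W : ∀ (R : Type) [CommRing R], Matrix (Fin p) (Fin p) R →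
      ((s : ι) → Matrix (Fin (r s)) (Fin (c s)) R) →
      (s : κ) → Matrix (Fin (r' s)) (Fin (c' s)) R)
    (M : TraceProduct (extSize p r) (extSize p c) a n)
    (N : List (ℕ × TraceProduct r' c' a n)) : Prop :=
  ∀ (R : Type) [CommRing R] [Algebra ℝ R] (β : ℝ) (G : Matrix (Fin p) (Fin p) R)
    (Δ : Fin p → Fin p → Derivation ℝ R R) (V : (s : ι) → Matrix (Fin (r s)) (Fin (c s)) R)
    (E : R →ₗ[ℝ] ℝ), IsGramDerivation G Δ → (∀ s i j k l, Δ k l (V s i j) = 0) →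
    IsGramFunctional β G Δ E → ∀ i j, E (M.evalIn (extValue G V) i j) =
      (N.map fun s => β ^ s.1 * E (s.2.evalIn (W R G V) i j)).sum

theorem exists_isGramReduction_of_head (M : TraceProduct (extSize p r) (extSize p c) a n)
    (hM : M.head.splits ≠ []) : ∃ N : List (ℕ × TraceProduct (extSize p r) (extSize p c) a n),
      (∀ s ∈ N, s.1 ≤ 1 ∧ ∀ ν : Option ι → ℕ, s.2.weight ν + ν none = M.weight ν) ∧
      IsGramReduction (fun _ _ => extValue) M N := by
  obtain ⟨s, hs⟩ := List.exists_mem_of_ne_nil _ hM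
  -- The exponent of `β` is 0 for the $\delta_{kl}$ term and 1 for the derivative terms.
  refine ⟨(0, ⟨M.traces, s.1.append s.2⟩) :: (steinTerms s.1 s.2 M.traces).map fun T => (1, T),
    ?_, ?_⟩
  · have h := fun ν => MulTerm.weight_of_mem_splits ν M.head s hs
    intro u hu
    simp only [List.mem_cons, List.mem_map] at hu
    rcases hu with rfl | ⟨T, hT, rfl⟩
    · refine ⟨Nat.zero_le _, fun ν => ?_⟩
      simp only [TraceProduct.weight, MulTerm.weight_append, ← h ν]
      ring
    · refine ⟨le_rfl, fun ν => ?_⟩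
      rw [weight_of_mem_steinTerms ν _ _ _ T hT, TraceProduct.weight, ← h ν]
      ring
  · intro R _ _ β G Δ V E h hV hE i j
    rw [hE.apply_evalIn h hV M hs i j]
    simp [List.map_map, Function.comp_def, List.sum_map_mul_left]

theorem MulTerm.splits_ne_nil {w : MulTerm (extSize p r) (extSize p c) a n}
    (hw : w.weight gramDegree ≠ 0) : w.splits ≠ [] := by
  intro h
  obtain ⟨v, hv, -⟩ := w.exists_of_splits_eq_nil h
  rw [← hv] at hw
  refine hw ?_
  have : ∀ {a n : ℕ} (v : MulTerm r c a n), v.weight (fun _ => 0) = 0 := fun v => by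
    induction v <;> simp_all [MulTerm.weight]
  exact this v

/-- If $G$ occurs only under traces, one such trace is the sum of the diagonal entries of its word.
The case of an occurrence in the head applies to each of these entries, with the entry of the actual
head as a constant factor. -/
theorem exists_isGramReduction_of_traces (M : TraceProduct (extSize p r) (extSize p c) a n)
    (hM : M.head.splits = []) (hd : M.weight gramDegree ≠ 0) :
    ∃ N : List (ℕ × TraceProduct (extSize p r) (extSize p c) a n),
      (∀ s ∈ N, s.1 ≤ 1 ∧ ∀ ν : Option ι → ℕ, s.2.weight ν + ν none = M.weight ν) ∧
      IsGramReduction (fun _ _ => extValue) M N := by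
  have hh : M.head.weight gramDegree = 0 := by
    by_contra h
    exact MulTerm.splits_ne_nil h hM
  rw [TraceProduct.weight, hh, add_zero, Ne, List.sum_eq_zero_iff] at hd
  push Not at hd
  obtain ⟨x, hx, hx0⟩ := hd
  obtain ⟨⟨m, w⟩, hT, rfl⟩ := List.mem_map.1 hx
  obtain ⟨l₁, l₂, hl⟩ := List.append_of_mem hT
  have hperm : M.traces.Perm (⟨m, w⟩ :: (l₁ ++ l₂)) := hl ▸ List.perm_middle
  obtain ⟨N, hN, hN'⟩ := exists_isGramReduction_of_head
    (⟨l₁ ++ l₂, w⟩ : TraceProduct (extSize p r) (extSize p c) m m) (MulTerm.splits_ne_nil hx0)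
  refine ⟨N.map fun s => (s.1, ⟨⟨m, s.2.head⟩ :: s.2.traces, M.head⟩), ?_, ?_⟩
  · intro u hu
    obtain ⟨s, hs, rfl⟩ := List.mem_map.1 hu
    refine ⟨(hN s hs).1, fun ν => ?_⟩
    have h1 := (hN s hs).2 ν
    have h2 := (hperm.map fun T => T.2.weight ν).sum_eq
    simp only [List.map_cons, List.sum_cons, TraceProduct.weight] at h1 h2 ⊢
    omega
  · intro R _ _ β G Δ V E h hV hE i j
    set x := M.head.evalIn (extValue G V) i j with hx
    have hx0 : ∀ k l, Δ k l x = 0 := fun k l => by rw [hx, h.apply_evalIn hV, hM]; rfl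
    -- The head entry `x` contains no $G$, so every `Δ k l` annihilates it and $\Phi\mapsto
    -- E(x\Phi)$ satisfies the same integration by parts formula.
    have hE' : IsGramFunctional β G Δ (E ∘ₗ LinearMap.mulLeft ℝ x) := by
      intro k l Φ
      have h1 := hE k l (x * Φ)
      simp only [Derivation.leibniz, smul_eq_mul, hx0, mul_zero, add_zero] at h1
      simpa [mul_left_comm x] using h1
    have hkey := fun y => hN' R β G Δ V _ h hV hE' y y
    have h1 : ∀ T : TraceProduct (extSize p r) (extSize p c) m m,
        ∑ y, (E ∘ₗ LinearMap.mulLeft ℝ x) (T.evalIn (extValue G V) y y) =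
        E ((⟨⟨m, T.head⟩ :: T.traces, M.head⟩ : TraceProduct _ _ a n).evalIn
          (extValue G V) i j) := by
      intro T
      rw [← map_sum, LinearMap.comp_apply, LinearMap.mulLeft_apply]
      congr 1
      simp only [TraceProduct.evalIn, TraceProduct.tracesIn, Matrix.smul_apply, smul_eq_mul,
        List.map_cons, List.prod_cons, ← hx, ← Finset.mul_sum, Matrix.trace, Matrix.diag_apply]
      ring
    have h2 : E (M.evalIn (extValue G V) i j) =
        E ((⟨⟨m, w⟩ :: (l₁ ++ l₂), M.head⟩ : TraceProduct _ _ a n).evalIn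
          (extValue G V) i j) := by
      have := (hperm.map fun T => (T.2.evalIn (extValue G V)).trace).prod_eq
      simp only [TraceProduct.evalIn, TraceProduct.tracesIn, this]
    rw [h2, ← h1 ⟨l₁ ++ l₂, w⟩, Finset.sum_congr rfl fun y _ => hkey y, Finset.sum_list_sum_map,
      List.map_map]
    simp only [← Finset.mul_sum, h1, Function.comp_def]

/-- Trace products without the added letter are trace products over the original alphabet. -/
theorem exists_of_gramDegree_eq_zero (M : TraceProduct (extSize p r) (extSize p c) a n)
    (hM : M.weight gramDegree = 0) : ∃ N : TraceProduct r c a n,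
      (∀ ν : Option ι → ℕ, N.weight (fun s => ν (some s)) = M.weight ν) ∧
      ∀ (R : Type) [CommRing R] (G : Matrix (Fin p) (Fin p) R)
        (V : (s : ι) → Matrix (Fin (r s)) (Fin (c s)) R),
        M.evalIn (extValue G V) = N.evalIn V := by
  have key : ∀ {a n : ℕ} (w : MulTerm (extSize p r) (extSize p c) a n),
      w.weight gramDegree = 0 → w.splits = [] := fun w hw => by
    by_contra h
    obtain ⟨s, hs⟩ := List.exists_mem_of_ne_nil _ h
    have := MulTerm.weight_of_mem_splits gramDegree w s hs
    simp [hw, gramDegree] at this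
  obtain ⟨ts, h⟩ := M
  simp only [TraceProduct.weight, Nat.add_eq_zero_iff, List.sum_eq_zero_iff, List.mem_map,
    forall_exists_index, and_imp, forall_apply_eq_imp_iff₂] at hM
  obtain ⟨h', hh, hh'⟩ := h.exists_of_splits_eq_nil (key h hM.2)
  have hts : ∃ ts' : List (Σ k : ℕ, MulTerm r c k k),
      (∀ ν : Option ι → ℕ, (ts'.map fun T => T.2.weight fun s => ν (some s)).sum =
        (ts.map fun T => T.2.weight ν).sum) ∧
      ∀ (R : Type) [CommRing R] (G : Matrix (Fin p) (Fin p) R)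
        (V : (s : ι) → Matrix (Fin (r s)) (Fin (c s)) R),
        TraceProduct.tracesIn (extValue G V) ts = TraceProduct.tracesIn V ts' := by
    have hts := hM.1
    clear hM
    induction ts with
    | nil => exact ⟨[], fun _ => rfl, fun _ _ _ _ => rfl⟩
    | cons T ts ih =>
      obtain ⟨ts', h1, h2⟩ := ih fun T hT => hts T (List.mem_cons_of_mem _ hT)
      obtain ⟨v, h3, h4⟩ := T.2.exists_of_splits_eq_nil (key _ (hts T List.mem_cons_self))
      refine ⟨⟨T.1, v⟩ :: ts', fun ν => ?_, fun R _ G V => ?_⟩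
      · simp only [List.map_cons, List.sum_cons, h1, h3]
      · have h5 := h2 R G V
        simp only [TraceProduct.tracesIn] at h5
        simp only [TraceProduct.tracesIn, List.map_cons, List.prod_cons, h4, h5]
  obtain ⟨ts', h1, h2⟩ := hts
  refine ⟨⟨ts', h'⟩, fun ν => ?_, fun R _ G V => ?_⟩
  · simp only [TraceProduct.weight, h1, hh]
  · simp only [TraceProduct.evalIn, h2, hh']

/-- Every expectation of a trace product that contains the Gram matrix is a polynomial in `β` whose
coefficients are expectations of trace products without the Gram matrix. -/
theorem exists_isGramReduction (d : ℕ) (M : TraceProduct (extSize p r) (extSize p c) a n)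
    (hM : M.weight gramDegree = d) : ∃ N : List (ℕ × TraceProduct r c a n),
      (∀ s ∈ N, s.1 ≤ d ∧ ∀ ν : Option ι → ℕ, ν none = 0 →
        s.2.weight (fun u => ν (some u)) = M.weight ν) ∧
      IsGramReduction (fun _ _ _ V => V) M N := by
  induction d generalizing M with
  | zero =>
    obtain ⟨N, h1, h2⟩ := exists_of_gramDegree_eq_zero M hM
    refine ⟨[(0, N)], ?_, ?_⟩
    · simp only [List.mem_singleton, forall_eq]
      exact ⟨le_rfl, fun ν _ => h1 ν⟩
    · intro R _ _ β G Δ V E h hV hE i j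
      simp [h2]
  | succ d ih =>
    obtain ⟨N, hN, hN'⟩ : ∃ N : List (ℕ × TraceProduct (extSize p r) (extSize p c) a n),
        (∀ s ∈ N, s.1 ≤ 1 ∧ ∀ ν : Option ι → ℕ, s.2.weight ν + ν none = M.weight ν) ∧
        IsGramReduction (fun _ _ => extValue) M N := by
      by_cases h : M.head.splits = []
      · exact exists_isGramReduction_of_traces M h (by omega)
      · exact exists_isGramReduction_of_head M h
    -- Placing the degree condition inside the existential makes `L` a total choice; terms of
    -- another degree get the empty list as a default value.
    have hex : ∀ T : TraceProduct (extSize p r) (extSize p c) a n,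
        ∃ L : List (ℕ × TraceProduct r c a n), T.weight gramDegree = d →
        (∀ s ∈ L, s.1 ≤ d ∧ ∀ ν : Option ι → ℕ, ν none = 0 →
          s.2.weight (fun u => ν (some u)) = T.weight ν) ∧
        IsGramReduction (fun _ _ _ V => V) T L := fun T => by
      by_cases h : T.weight gramDegree = d
      · obtain ⟨L, hL⟩ := ih T h
        exact ⟨L, fun _ => hL⟩
      · exact ⟨[], fun h' => absurd h' h⟩
    choose L hL using hex
    have hd : ∀ s ∈ N, s.2.weight gramDegree = d := fun s hs => by
      have := (hN s hs).2 gramDegree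
      simp only [hM, gramDegree] at this
      omega
    refine ⟨N.flatMap fun s => (L s.2).map fun u => (s.1 + u.1, u.2), ?_, ?_⟩
    · intro u hu
      obtain ⟨s, hs, v, hv, rfl⟩ := by simpa only [List.mem_flatMap, List.mem_map] using hu
      have h1 := (hL s.2 (hd s hs)).1 v hv
      refine ⟨?_, fun ν hν => ?_⟩
      · have := (hN s hs).1
        omega
      · rw [h1.2 ν hν, ← (hN s hs).2 ν, hν, add_zero]
    · intro R _ _ β G Δ V E h hV hE i j
      rw [hN' R β G Δ V E h hV hE i j, List.sum_flatMap_map]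
      congr 1
      refine List.map_congr_left fun s hs => ?_
      rw [(hL s.2 (hd s hs)).2 R β G Δ V E h hV hE i j, ← List.sum_map_mul_left, List.map_map]
      simp only [Function.comp_def, pow_add, mul_assoc]

end GramElimination

/-! ### Substituting linear combinations of words for letters. -/

section Substitution

variable {ι κ : Type} {r c : ι → ℕ} {r' c' : κ → ℕ} {a n : ℕ}

theorem List.sum_map_mul_sum_map_product {α β : Type*} {R : Type*} [CommRing R] {a m n : ℕ}
    (L : List α) (L' : List β) (f : α → Matrix (Fin a) (Fin m) R)
    (g : β → Matrix (Fin m) (Fin n) R) :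
    (L.map f).sum * (L'.map g).sum = ((L ×ˢ L').map fun x => f x.1 * g x.2).sum := by
  have h : ∀ (A : Matrix (Fin a) (Fin m) R) (L' : List β),
      A * (L'.map g).sum = (L'.map fun y => A * g y).sum := fun A L' => by
    induction L' with
    | nil => simp
    | cons y L' ih => simp [Matrix.mul_add, ih]
  induction L with
  | nil => simp
  | cons x L ih =>
    rw [List.map_cons, List.sum_cons, Matrix.add_mul, ih, h, List.product_cons, List.map_append,
      List.sum_append, List.map_map]
    rfl

/-- The letters `V` are the linear combinations `L` of words in the letters `V'`. -/
def IsSubstitution {R : Type} [CommRing R] [Algebra ℝ R]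
    (L : (s : ι) → List (ℝ × MulTerm r' c' (r s) (c s)))
    (V : (s : ι) → Matrix (Fin (r s)) (Fin (c s)) R)
    (V' : (s : κ) → Matrix (Fin (r' s)) (Fin (c' s)) R) : Prop :=
  ∀ s, V s = ((L s).map fun u => u.1 • u.2.evalIn V').sum

/-- The product is expanded by distributivity. The weights `ν` and `ω` are quantified after `N`, so
that one and the same expansion serves several degree counts; only an inequality is possible because
the words for one letter may have different weights. -/
theorem MulTerm.exists_substitution (A : Subalgebra ℤ ℝ)
    (L : (s : ι) → List (ℝ × MulTerm r' c' (r s) (c s))) (hA : ∀ s, ∀ u ∈ L s, u.1 ∈ A)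
    (w : MulTerm r c a n) : ∃ N : List (ℝ × MulTerm r' c' a n),
      (∀ u ∈ N, u.1 ∈ A ∧ ∀ (ν : κ → ℕ) (ω : ι → ℕ), (∀ s, ∀ v ∈ L s, v.2.weight ν ≤ ω s) →
        u.2.weight ν ≤ w.weight ω) ∧
      ∀ (R : Type) [CommRing R] [Algebra ℝ R] (V : (s : ι) → Matrix (Fin (r s)) (Fin (c s)) R)
        (V' : (s : κ) → Matrix (Fin (r' s)) (Fin (c' s)) R), IsSubstitution L V V' →
        w.evalIn V = (N.map fun u => u.1 • u.2.evalIn V').sum := by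
  induction w with
  | one n =>
    refine ⟨[(1, one n)], ?_, fun R _ _ V V' _ => by simp [evalIn]⟩
    simp only [List.mem_singleton, forall_eq]
    exact ⟨A.one_mem, fun ν ω _ => le_rfl⟩
  | mul s w ih =>
    obtain ⟨N, h1, h2⟩ := ih
    refine ⟨(L s ×ˢ N).map fun x => (x.1.1 * x.2.1, x.1.2.append x.2.2), ?_, ?_⟩
    · intro u hu
      obtain ⟨⟨x, y⟩, hxy, rfl⟩ := List.mem_map.1 hu
      obtain ⟨hx, hy⟩ := List.mem_product.1 hxy
      refine ⟨A.mul_mem (hA s x hx) (h1 y hy).1, fun ν ω h => ?_⟩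
      rw [weight_append, weight]
      exact add_le_add (h s x hx) ((h1 y hy).2 ν ω h)
    · intro R _ _ V V' h
      rw [evalIn, h2 R V V' h, h s, List.sum_map_mul_sum_map_product, List.map_map]
      simp [Function.comp_def, evalIn_append, smul_smul, mul_comm]
  | mulT s w ih =>
    obtain ⟨N, h1, h2⟩ := ih
    refine ⟨(L s ×ˢ N).map fun x => (x.1.1 * x.2.1, x.1.2.transpose.append x.2.2), ?_, ?_⟩
    · intro u hu
      obtain ⟨⟨x, y⟩, hxy, rfl⟩ := List.mem_map.1 hu
      obtain ⟨hx, hy⟩ := List.mem_product.1 hxy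
      refine ⟨A.mul_mem (hA s x hx) (h1 y hy).1, fun ν ω h => ?_⟩
      rw [weight_append, weight_transpose, weight]
      exact add_le_add (h s x hx) ((h1 y hy).2 ν ω h)
    · intro R _ _ V V' h
      rw [evalIn, h2 R V V' h, h s, Matrix.transpose_list_sum, List.map_map,
        List.sum_map_mul_sum_map_product, List.map_map]
      simp [Function.comp_def, evalIn_append, evalIn_transpose, smul_smul, mul_comm]

theorem TraceProduct.exists_substitution (A : Subalgebra ℤ ℝ)
    (L : (s : ι) → List (ℝ × MulTerm r' c' (r s) (c s))) (hA : ∀ s, ∀ u ∈ L s, u.1 ∈ A)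
    (M : TraceProduct r c a n) : ∃ N : List (ℝ × TraceProduct r' c' a n),
      (∀ u ∈ N, u.1 ∈ A ∧ ∀ (ν : κ → ℕ) (ω : ι → ℕ), (∀ s, ∀ v ∈ L s, v.2.weight ν ≤ ω s) →
        u.2.weight ν ≤ M.weight ω) ∧
      ∀ (R : Type) [CommRing R] [Algebra ℝ R] (V : (s : ι) → Matrix (Fin (r s)) (Fin (c s)) R)
        (V' : (s : κ) → Matrix (Fin (r' s)) (Fin (c' s)) R), IsSubstitution L V V' →
        M.evalIn V = (N.map fun u => u.1 • u.2.evalIn V').sum := by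
  obtain ⟨ts, w⟩ := M
  induction ts with
  | nil =>
    obtain ⟨N, h1, h2⟩ := w.exists_substitution A L hA
    refine ⟨N.map fun u => (u.1, ⟨[], u.2⟩), ?_, ?_⟩
    · intro u hu
      obtain ⟨v, hv, rfl⟩ := List.mem_map.1 hu
      exact ⟨(h1 v hv).1, fun ν ω h => by simpa [weight] using (h1 v hv).2 ν ω h⟩
    · intro R _ _ V V' h
      simp [evalIn, tracesIn, h2 R V V' h, List.map_map, Function.comp_def]
  | cons T ts ih =>
    obtain ⟨N, h1, h2⟩ := ih
    obtain ⟨N', h3, h4⟩ := T.2.exists_substitution A L hA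
    refine ⟨(N' ×ˢ N).map fun x =>
      (x.1.1 * x.2.1, ⟨⟨T.1, x.1.2⟩ :: x.2.2.traces, x.2.2.head⟩), ?_, ?_⟩
    · intro u hu
      obtain ⟨⟨x, y⟩, hxy, rfl⟩ := List.mem_map.1 hu
      obtain ⟨hx, hy⟩ := List.mem_product.1 hxy
      refine ⟨A.mul_mem (h3 x hx).1 (h1 y hy).1, fun ν ω h => ?_⟩
      have h5 := (h3 x hx).2 ν ω h
      have h6 := (h1 y hy).2 ν ω h
      simp only [weight, List.map_cons, List.sum_cons] at h6 ⊢
      omega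
    · intro R _ _ V V' h
      have h5 : (⟨T :: ts, w⟩ : TraceProduct r c a n).evalIn V =
          (T.2.evalIn V).trace • (⟨ts, w⟩ : TraceProduct r c a n).evalIn V := by
        simp [evalIn, tracesIn, smul_smul]
      have h7 : ∀ (P : List (ℝ × MulTerm r' c' T.1 T.1)) (Q : List (ℝ × TraceProduct r' c' a n)),
          Matrix.trace (P.map fun u => u.1 • u.2.evalIn V').sum •
            (Q.map fun u => u.1 • u.2.evalIn V').sum =
          ((P ×ˢ Q).map fun x => (x.1.1 * x.2.1) •
            (⟨⟨T.1, x.1.2⟩ :: x.2.2.traces, x.2.2.head⟩ : TraceProduct r' c' a n).evalIn V').sum := by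
        intro P Q
        induction P with
        | nil => simp
        | cons x P ih =>
          rw [List.map_cons, List.sum_cons, Matrix.trace_add, add_smul, ih, List.product_cons,
            List.map_append, List.sum_append, List.map_map, List.smul_sum, List.map_map]
          congr 3
          funext y
          simp only [Function.comp_apply, evalIn, tracesIn, Matrix.trace_smul, List.map_cons,
            List.prod_cons, ← smul_smul, smul_assoc]
          rw [smul_comm _ y.1]
      rw [h5, h2 R V V' h, h4 R V V' h, h7, List.map_map]
      rfl

end Substitution

theorem MulTerm.weight_fun_add {ι : Type} {r c : ι → ℕ} {a n : ℕ} (w : MulTerm r c a n)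
    (ν ω : ι → ℕ) : w.weight (fun u => ν u + ω u) = w.weight ν + w.weight ω := by
  induction w with
  | one n => rfl
  | mul s w ih | mulT s w ih =>
    simp only [weight, ih]
    ring

theorem TraceProduct.weight_fun_add {ι : Type} {r c : ι → ℕ} {a n : ℕ} (M : TraceProduct r c a n)
    (ν ω : ι → ℕ) : M.weight (fun u => ν u + ω u) = M.weight ν + M.weight ω := by
  simp only [weight, MulTerm.weight_fun_add, List.sum_map_add]
  ring

/-! ### Gradients and descent steps as substitutions; averaging over one mini-batch. -/

section Network

variable {R R' : Type*} [CommRing R] [CommRing R'] {p p₁ p₂ : ℕ}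

/-- The weights of a two-layer linear network over a commutative ring. -/
abbrev WeightsIn (R : Type*) (p p₁ p₂ : ℕ) : Type _ :=
  Matrix (Fin p₁) (Fin p) R × Matrix (Fin p₂) (Fin p₁) R

/-- The gradient with respect to the first layer for the Gram matrix `G` of the samples. -/
def gradIn₁ (S W : WeightsIn R p p₁ p₂) (G : Matrix (Fin p) (Fin p) R) :
    Matrix (Fin p₁) (Fin p) R :=
  W.2ᵀ * (W.2 * W.1 - S.2 * S.1) * G

/-- The gradient with respect to the second layer for the Gram matrix `G` of the samples. -/
def gradIn₂ (S W : WeightsIn R p p₁ p₂) (G : Matrix (Fin p) (Fin p) R) :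
    Matrix (Fin p₂) (Fin p₁) R :=
  (W.2 * W.1 - S.2 * S.1) * G * W.1ᵀ

/-- The values of the weight letters over a commutative ring. -/
def weightValueIn (S W : WeightsIn R p p₁ p₂) :
    (s : WeightSymbol) → Matrix (Fin (s.rows p p₁ p₂)) (Fin (s.cols p p₁ p₂)) R
  | .student₁ => W.1
  | .student₂ => W.2
  | .teacher₁ => S.1
  | .teacher₂ => S.2

/-- The values of the letters of a step over a commutative ring. -/
def stepValueIn (S W : WeightsIn R p p₁ p₂) (G : Matrix (Fin p) (Fin p) R) :
    (s : StepSymbol) → Matrix (Fin (s.rows p p₁ p₂)) (Fin (s.cols p p₁ p₂)) R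
  | .grad₁ => gradIn₁ S W G
  | .grad₂ => gradIn₂ S W G
  | .student₁ => W.1
  | .student₂ => W.2
  | .teacher₁ => S.1
  | .teacher₂ => S.2

/-- One step of gradient descent with step size `α`. -/
def descendIn [Algebra ℝ R] (α : ℝ) (S W : WeightsIn R p p₁ p₂) (G : Matrix (Fin p) (Fin p) R) :
    WeightsIn R p p₁ p₂ :=
  (W.1 - α • gradIn₁ S W G, W.2 - α • gradIn₂ S W G)

/-- Gradient descent with the Gram matrices `G 0, G 1, …`. -/
def sgdIn [Algebra ℝ R] (α : ℕ → ℝ) (S W₀ : WeightsIn R p p₁ p₂)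
    (G : ℕ → Matrix (Fin p) (Fin p) R) : ℕ → WeightsIn R p p₁ p₂
  | 0 => W₀
  | t + 1 => descendIn (α t) S (sgdIn α S W₀ G t) (G t)

/-- Words for the terms of the gradients, where the added letter is the Gram matrix. -/
def gradWords (p p₁ p₂ : ℕ) : (s : StepSymbol) →
    List (ℝ × MulTerm (extSize p (WeightSymbol.rows p p₁ p₂))
      (extSize p (WeightSymbol.cols p p₁ p₂)) (s.rows p p₁ p₂) (s.cols p p₁ p₂))
  | .grad₁ =>
    [(1, .oldT WeightSymbol.student₂ (.old WeightSymbol.student₂ (.old WeightSymbol.student₁ (.gram (.one p))))),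
      (-1, .oldT WeightSymbol.student₂ (.old WeightSymbol.teacher₂ (.old WeightSymbol.teacher₁ (.gram (.one p)))))]
  | .grad₂ =>
    [(1, .old WeightSymbol.student₂ (.old WeightSymbol.student₁ (.gram (.oldT WeightSymbol.student₁ (.one p₁))))),
      (-1, .old WeightSymbol.teacher₂ (.old WeightSymbol.teacher₁ (.gram (.oldT WeightSymbol.student₁ (.one p₁)))))]
  | .student₁ => [(1, .old WeightSymbol.student₁ (.one p))]
  | .student₂ => [(1, .old WeightSymbol.student₂ (.one p₁))]
  | .teacher₁ => [(1, .old WeightSymbol.teacher₁ (.one p))]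
  | .teacher₂ => [(1, .old WeightSymbol.teacher₂ (.one p₁))]

theorem isSubstitution_gradWords {R : Type} [CommRing R] [Algebra ℝ R]
    (S W : WeightsIn R p p₁ p₂) (G : Matrix (Fin p) (Fin p) R) :
    IsSubstitution (gradWords p p₁ p₂) (stepValueIn S W G) (extValue G (weightValueIn S W)) := by
  have h1 : ∀ {a m n l : ℕ} (A : Matrix (Fin a) (Fin m) R) (B C : Matrix (Fin m) (Fin n) R)
      (D : Matrix (Fin n) (Fin l) R), A * (B - C) * D = A * (B * D) - A * (C * D) := by
    intro a m n l A B C D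
    rw [Matrix.mul_assoc, Matrix.sub_mul, Matrix.mul_sub]
  -- `I` and `J` are the values of the empty words that end the words of `gradWords`. Keeping them
  -- makes the identities below agree with the evaluated words by unfolding.
  let I : Matrix (Fin p) (Fin p) R := 1
  let J : Matrix (Fin p₁) (Fin p₁) R := 1
  have hg₁ : W.2ᵀ * (W.2 * W.1 - S.2 * S.1) * G =
      (1 : ℝ) • (W.2ᵀ * (W.2 * (W.1 * (G * I)))) +
        ((-1 : ℝ) • (W.2ᵀ * (S.2 * (S.1 * (G * I)))) + 0) := by
    rw [h1]
    simp [I, Matrix.mul_assoc, sub_eq_add_neg]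
  have hg₂ : (W.2 * W.1 - S.2 * S.1) * G * W.1ᵀ =
      (1 : ℝ) • (W.2 * (W.1 * (G * (W.1ᵀ * J)))) +
        ((-1 : ℝ) • (S.2 * (S.1 * (G * (W.1ᵀ * J)))) + 0) := by
    rw [Matrix.sub_mul, Matrix.sub_mul]
    simp [J, Matrix.mul_assoc, sub_eq_add_neg]
  have h₁ : ∀ A : Matrix (Fin p₁) (Fin p) R, A = (1 : ℝ) • (A * I) + 0 := fun A => by simp [I]
  have h₂ : ∀ A : Matrix (Fin p₂) (Fin p₁) R, A = (1 : ℝ) • (A * J) + 0 := fun A => by simp [J]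
  intro s
  cases s
  exacts [hg₁, hg₂, h₁ W.1, h₂ W.2, h₁ S.1, h₂ S.2]

/-- Words for the terms of the weights after one more step. -/
def descendWords (p p₁ p₂ : ℕ) (α : ℝ) : (s : WeightSymbol) →
    List (ℝ × MulTerm (StepSymbol.rows p p₁ p₂) (StepSymbol.cols p p₁ p₂)
      (s.rows p p₁ p₂) (s.cols p p₁ p₂))
  | .student₁ => [(1, .mul StepSymbol.student₁ (.one p)), (-α, .mul StepSymbol.grad₁ (.one p))]
  | .student₂ => [(1, .mul StepSymbol.student₂ (.one p₁)), (-α, .mul StepSymbol.grad₂ (.one p₁))]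
  | .teacher₁ => [(1, .mul StepSymbol.teacher₁ (.one p))]
  | .teacher₂ => [(1, .mul StepSymbol.teacher₂ (.one p₁))]

theorem isSubstitution_descendWords {R : Type} [CommRing R] [Algebra ℝ R] (α : ℝ)
    (S W : WeightsIn R p p₁ p₂) (G : Matrix (Fin p) (Fin p) R) :
    IsSubstitution (descendWords p p₁ p₂ α) (weightValueIn S (descendIn α S W G))
      (stepValueIn S W G) := by
  let I : Matrix (Fin p) (Fin p) R := 1
  let J : Matrix (Fin p₁) (Fin p₁) R := 1
  have hd₁ : W.1 - α • gradIn₁ S W G =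
      (1 : ℝ) • (W.1 * I) + ((-α) • (gradIn₁ S W G * I) + 0) := by
    simp [I, sub_eq_add_neg]
  have hd₂ : W.2 - α • gradIn₂ S W G =
      (1 : ℝ) • (W.2 * J) + ((-α) • (gradIn₂ S W G * J) + 0) := by
    simp [J, sub_eq_add_neg]
  have h₁ : S.1 = (1 : ℝ) • (S.1 * I) + 0 := by simp [I]
  have h₂ : S.2 = (1 : ℝ) • (S.2 * J) + 0 := by simp [J]
  intro s
  cases s
  exacts [hd₁, hd₂, h₁, h₂]

theorem WeightTraceProduct.totalDegree_eq {a n : ℕ} (M : WeightTraceProduct p p₁ p₂ a n) :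
    M.totalDegree = M.weight fun u => 1 * (if u = .student₁ then 1 else 0) +
      1 * (if u = .student₂ then 1 else 0) := by
  rw [TraceProduct.weight_add, one_mul, one_mul]
  rfl

/-- All bounds have the form $kd+ld'$. As a single letter weight they fit the substitution lemma. -/
theorem StepTraceProduct.combine_degrees {a n : ℕ} (M : StepTraceProduct p p₁ p₂ a n) (k l : ℕ) :
    k * M.gradDegree + l * M.studentDegree = M.weight fun u =>
      (k * (if u = .grad₁ then 1 else 0) + k * (if u = .grad₂ then 1 else 0)) +
      (l * (if u = .student₁ then 1 else 0) + l * (if u = .student₂ then 1 else 0)) := by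
  rw [TraceProduct.weight_fun_add, TraceProduct.weight_add, TraceProduct.weight_add, gradDegree,
    studentDegree]
  ring

/-- The expectation over one mini-batch. -/
theorem exists_batch_expectation {a n : ℕ} (M : StepTraceProduct p p₁ p₂ a n) :
    ∃ N : List (ℝ × ℕ × WeightTraceProduct p p₁ p₂ a n),
      (∀ s ∈ N, s.1 ∈ (⊥ : Subalgebra ℤ ℝ) ∧ s.2.1 ≤ M.gradDegree ∧
        s.2.2.totalDegree ≤ 3 * M.gradDegree + M.studentDegree) ∧
      ∀ (R : Type) [CommRing R] [Algebra ℝ R] (β : ℝ) (G : Matrix (Fin p) (Fin p) R)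
        (Δ : Fin p → Fin p → Derivation ℝ R R) (S W : WeightsIn R p p₁ p₂) (E : R →ₗ[ℝ] ℝ),
        IsGramDerivation G Δ → (∀ s i j k l, Δ k l (weightValueIn S W s i j) = 0) →
        IsGramFunctional β G Δ E → ∀ i j, E (M.evalIn (stepValueIn S W G) i j) =
          (N.map fun s => s.1 * β ^ s.2.1 * E (s.2.2.evalIn (weightValueIn S W) i j)).sum := by
  have hcoef : ∀ s, ∀ u ∈ gradWords p p₁ p₂ s, u.1 ∈ (⊥ : Subalgebra ℤ ℝ) := by
    intro s u hu
    have h1 : (1 : ℝ) ∈ (⊥ : Subalgebra ℤ ℝ) := one_mem _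
    have h2 : (-1 : ℝ) ∈ (⊥ : Subalgebra ℤ ℝ) := neg_mem h1
    cases s <;> simp only [gradWords, List.mem_cons, List.not_mem_nil, or_false] at hu
    · rcases hu with rfl | rfl <;> assumption
    · rcases hu with rfl | rfl <;> assumption
    all_goals subst hu; exact h1
  obtain ⟨N, hN, hN'⟩ := M.exists_substitution ⊥ (gradWords p p₁ p₂) hcoef
  choose L hL hL' using fun T : TraceProduct (extSize p (WeightSymbol.rows p p₁ p₂))
    (extSize p (WeightSymbol.cols p p₁ p₂)) a n => exists_isGramReduction _ T rfl
  -- Each word for a gradient contains one $G$ and each word for another letter none, which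
  -- corresponds to the coefficients $k=1$, $l=0$.
  have hgram : ∀ u ∈ N, u.2.weight gramDegree ≤ M.gradDegree := by
    intro u hu
    have h := M.combine_degrees 1 0
    rw [one_mul, zero_mul, add_zero] at h
    rw [h]
    refine (hN u hu).2 _ _ fun s v hv => ?_
    cases s <;> simp only [gradWords, List.mem_cons, List.not_mem_nil, or_false] at hv
    · rcases hv with rfl | rfl <;> exact le_rfl
    · rcases hv with rfl | rfl <;> exact le_rfl
    all_goals subst hv; exact le_rfl
  have hdeg : ∀ u ∈ N, ∀ s ∈ L u.2,
      WeightTraceProduct.totalDegree s.2 ≤ 3 * M.gradDegree + M.studentDegree := by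
    intro u hu s hs
    have h := M.combine_degrees 3 1
    rw [one_mul] at h
    rw [h, WeightTraceProduct.totalDegree_eq]
    -- The added letter gets weight 0, so eliminating $G$ leaves the student degree unchanged.
    have h1 := (hL u.2 s hs).2 (fun v => v.elim 0 fun w =>
      1 * (if w = .student₁ then 1 else 0) + 1 * (if w = .student₂ then 1 else 0)) rfl
    refine h1.trans_le ((hN u hu).2 _ _ fun s v hv => ?_)
    cases s <;> simp only [gradWords, List.mem_cons, List.not_mem_nil, or_false] at hv
    -- Of the two words of a gradient, the one without teacher letters has three student letters and
    -- the other has one.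
    · rcases hv with rfl | rfl
      exacts [Nat.le_refl 3, (by norm_num : 1 ≤ 3)]
    · rcases hv with rfl | rfl
      exacts [Nat.le_refl 3, (by norm_num : 1 ≤ 3)]
    all_goals subst hv; exact le_rfl
  refine ⟨N.flatMap fun u => (L u.2).map fun s => (u.1, s.1, s.2), ?_, ?_⟩
  · intro s hs
    obtain ⟨u, hu, v, hv, rfl⟩ := by simpa only [List.mem_flatMap, List.mem_map] using hs
    exact ⟨(hN u hu).1, (hL u.2 v hv).1.trans (hgram u hu), hdeg u hu v hv⟩
  · intro R _ _ β G Δ S W E h hV hE i j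
    rw [hN' R _ _ (isSubstitution_gradWords S W G), Matrix.list_sum_map_apply, map_list_sum,
      List.map_map, List.sum_flatMap_map]
    congr 2
    funext u
    simp only [Function.comp_apply, Matrix.smul_apply, map_smul, smul_eq_mul,
      hL' u.2 R β G Δ _ E h hV hE, List.map_map, Function.comp_def, ← List.sum_map_mul_left,
      mul_assoc]

/-- A student letter becomes one student or one gradient letter of the preceding step, with
coefficient $1$ or $-\alpha$; the combined degree therefore cannot grow. -/
theorem exists_descend {a n : ℕ} (A : Subalgebra ℤ ℝ) {α : ℝ} (hα : α ∈ A)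
    (M : WeightTraceProduct p p₁ p₂ a n) : ∃ N : List (ℝ × StepTraceProduct p p₁ p₂ a n),
      (∀ s ∈ N, s.1 ∈ A ∧
        StepTraceProduct.gradDegree s.2 + StepTraceProduct.studentDegree s.2 ≤ M.totalDegree) ∧
      ∀ (R : Type) [CommRing R] [Algebra ℝ R] (G : Matrix (Fin p) (Fin p) R)
        (S W : WeightsIn R p p₁ p₂), M.evalIn (weightValueIn S (descendIn α S W G)) =
          (N.map fun s => s.1 • s.2.evalIn (stepValueIn S W G)).sum := by
  have hcoef : ∀ s, ∀ u ∈ descendWords p p₁ p₂ α s, u.1 ∈ A := by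
    intro s u hu
    have h1 : (1 : ℝ) ∈ A := one_mem _
    have h2 : -α ∈ A := neg_mem hα
    cases s <;> simp only [descendWords, List.mem_cons, List.not_mem_nil, or_false] at hu
    · rcases hu with rfl | rfl <;> assumption
    · rcases hu with rfl | rfl <;> assumption
    all_goals subst hu; exact h1
  obtain ⟨N, hN, hN'⟩ := M.exists_substitution A (descendWords p p₁ p₂ α) hcoef
  refine ⟨N, fun u hu => ⟨(hN u hu).1, ?_⟩,
    fun R _ _ G S W => hN' R _ _ (isSubstitution_descendWords α S W G)⟩
  have h := StepTraceProduct.combine_degrees u.2 1 1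
  rw [one_mul, one_mul] at h
  rw [h, WeightTraceProduct.totalDegree_eq]
  refine (hN u hu).2 _ _ fun s v hv => ?_
  cases s <;> simp only [descendWords, List.mem_cons, List.not_mem_nil, or_false] at hv
  · rcases hv with rfl | rfl <;> exact le_rfl
  · rcases hv with rfl | rfl <;> exact le_rfl
  all_goals subst hv; exact le_rfl

end Network

/-! ### Induction on the number of steps. -/

section Iteration

variable {p p₁ p₂ : ℕ}

section

variable {R : Type*} [CommRing R] [Algebra ℝ R] {A : Subalgebra ℝ R}

theorem Matrix.mul_apply_mem {a m n : ℕ} {X : Matrix (Fin a) (Fin m) R}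
    {Y : Matrix (Fin m) (Fin n) R} (hX : ∀ i j, X i j ∈ A) (hY : ∀ i j, Y i j ∈ A) (i j) :
    (X * Y) i j ∈ A := by
  rw [Matrix.mul_apply]
  exact A.sum_mem fun k _ => A.mul_mem (hX i k) (hY k j)

theorem residual_mem {S W : WeightsIn R p p₁ p₂} (hS : ∀ s i j, weightValueIn S W s i j ∈ A)
    (i j) : (W.2 * W.1 - S.2 * S.1) i j ∈ A :=
  A.sub_mem (Matrix.mul_apply_mem (hS .student₂) (hS .student₁) i j)
    (Matrix.mul_apply_mem (hS .teacher₂) (hS .teacher₁) i j)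

theorem gradIn₁_mem {S W : WeightsIn R p p₁ p₂} {G : Matrix (Fin p) (Fin p) R}
    (hS : ∀ s i j, weightValueIn S W s i j ∈ A) (hG : ∀ i j, G i j ∈ A) :
    ∀ i j, gradIn₁ S W G i j ∈ A :=
  Matrix.mul_apply_mem (Matrix.mul_apply_mem (fun i j => hS .student₂ j i) (residual_mem hS)) hG

theorem gradIn₂_mem {S W : WeightsIn R p p₁ p₂} {G : Matrix (Fin p) (Fin p) R}
    (hS : ∀ s i j, weightValueIn S W s i j ∈ A) (hG : ∀ i j, G i j ∈ A) :
    ∀ i j, gradIn₂ S W G i j ∈ A :=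
  Matrix.mul_apply_mem (Matrix.mul_apply_mem (residual_mem hS) hG) fun i j => hS .student₁ j i

theorem stepValueIn_mem {S W : WeightsIn R p p₁ p₂} {G : Matrix (Fin p) (Fin p) R}
    (hS : ∀ s i j, weightValueIn S W s i j ∈ A) (hG : ∀ i j, G i j ∈ A) (s i j) :
    stepValueIn S W G s i j ∈ A := by
  cases s
  exacts [gradIn₁_mem hS hG _ _, gradIn₂_mem hS hG _ _, hS .student₁ _ _, hS .student₂ _ _,
    hS .teacher₁ _ _, hS .teacher₂ _ _]

/-- The weights are polynomial in the initial weights, the teacher and the earlier Gram matrices.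
The choice of `A` gives different facts: the kernel of a derivation makes past weights constant,
while algebras of functions yield measurability and finite moments. -/
theorem sgdIn_mem {α : ℕ → ℝ} {S W₀ : WeightsIn R p p₁ p₂} {G : ℕ → Matrix (Fin p) (Fin p) R}
    (hS : ∀ s i j, weightValueIn S W₀ s i j ∈ A) (t : ℕ) (hG : ∀ u < t, ∀ i j, G u i j ∈ A) :
    ∀ s i j, weightValueIn S (sgdIn α S W₀ G t) s i j ∈ A := by
  induction t with
  | zero => exact hS
  | succ t ih =>
    have ih' := ih fun u hu => hG u (hu.trans t.lt_succ_self)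
    have hG' := hG t t.lt_succ_self
    intro s
    cases s
    · exact fun i j => A.sub_mem (ih' .student₁ i j) (A.smul_mem (gradIn₁_mem ih' hG' i j) _)
    · exact fun i j => A.sub_mem (ih' .student₂ i j) (A.smul_mem (gradIn₂_mem ih' hG' i j) _)
    · exact hS .teacher₁
    · exact hS .teacher₂

/-- The elements that a derivation annihilates. -/
def Derivation.kerSubalgebra (D : Derivation ℝ R R) : Subalgebra ℝ R where
  carrier := {x | D x = 0}
  mul_mem' {x y} hx hy := by
    have hx' : D x = 0 := hx
    have hy' : D y = 0 := hy
    simp [hx', hy']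
  add_mem' {x y} hx hy := by
    have hx' : D x = 0 := hx
    have hy' : D y = 0 := hy
    simp [hx', hy']
  algebraMap_mem' x := D.map_algebraMap x

end

/-- The sum `1 + 3 + ⋯ + 3^(t-1)`. -/
def geomThree (t : ℕ) : ℕ := ∑ i ∈ Finset.range t, 3 ^ i

theorem geomThree_succ (t : ℕ) : geomThree (t + 1) = 3 * geomThree t + 1 := by
  rw [geomThree, Finset.sum_range_succ', geomThree, Finset.mul_sum]
  simp only [pow_succ, pow_zero, mul_comm]

theorem geomThree_cast (t : ℕ) : (geomThree t : ℝ) = 1 / 2 * (3 ^ t - 1) := by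
  induction t with
  | zero => simp [geomThree]
  | succ t ih =>
    rw [geomThree_succ]
    push_cast
    rw [ih]
    ring

/-- The expectation after `t` steps, for every expectation functional that satisfies the integration
by parts formulas of the Gram matrices of all mini-batches. -/
theorem exists_sgd_expectation (α : ℕ → ℝ) (t : ℕ) {a n : ℕ} (M : StepTraceProduct p p₁ p₂ a n) :
    ∃ N : List (ℝ × ℕ × WeightTraceProduct p p₁ p₂ a n),
      (∀ s ∈ N, s.1 ∈ Algebra.adjoin ℤ (α '' Set.Iio t) ∧
        s.2.1 ≤ geomThree (t + 1) * M.gradDegree + geomThree t * M.studentDegree ∧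
        WeightTraceProduct.totalDegree s.2.2 ≤
          3 ^ t * (3 * M.gradDegree + M.studentDegree)) ∧
      ∀ (R : Type) [CommRing R] [Algebra ℝ R] (β : ℝ) (G : ℕ → Matrix (Fin p) (Fin p) R)
        (Δ : ℕ → Fin p → Fin p → Derivation ℝ R R) (S W₀ : WeightsIn R p p₁ p₂) (E : R →ₗ[ℝ] ℝ),
        (∀ u, IsGramDerivation (G u) (Δ u)) → (∀ u, IsGramFunctional β (G u) (Δ u) E) →
        (∀ u v, u < v → ∀ i j k l, Δ v k l (G u i j) = 0) →
        (∀ u s i j k l, Δ u k l (weightValueIn S W₀ s i j) = 0) →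
        ∀ i j, E (M.evalIn (stepValueIn S (sgdIn α S W₀ G t) (G t)) i j) =
          (N.map fun s => s.1 * β ^ s.2.1 *
            E (s.2.2.evalIn (weightValueIn S W₀) i j)).sum := by
  -- The weights of step `t` involve only earlier mini-batches, so they are constants for the
  -- derivations of mini-batch `t`.
  have hker : ∀ (R : Type) [CommRing R] [Algebra ℝ R] (G : ℕ → Matrix (Fin p) (Fin p) R)
      (Δ : ℕ → Fin p → Fin p → Derivation ℝ R R) (S W₀ : WeightsIn R p p₁ p₂),
      (∀ u v, u < v → ∀ i j k l, Δ v k l (G u i j) = 0) →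
      (∀ u s i j k l, Δ u k l (weightValueIn S W₀ s i j) = 0) →
      ∀ t s i j k l, Δ t k l (weightValueIn S (sgdIn α S W₀ G t) s i j) = 0 :=
    fun R _ _ G Δ S W₀ hG hS t s i j k l =>
      sgdIn_mem (A := (Δ t k l).kerSubalgebra) (fun s i j => hS t s i j k l) t
        (fun u hu i j => hG u t hu i j k l) s i j
  induction t generalizing M with
  | zero =>
    obtain ⟨N, hN, hN'⟩ := exists_batch_expectation M
    refine ⟨N, fun s hs => ⟨bot_le (a := Algebra.adjoin ℤ _) (hN s hs).1, ?_, ?_⟩, ?_⟩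
    · simpa [geomThree] using (hN s hs).2.1
    · simpa using (hN s hs).2.2
    · intro R _ _ β G Δ S W₀ E h hE hG hS i j
      exact hN' R β (G 0) (Δ 0) S W₀ E (h 0) (hS 0) (hE 0) i j
  | succ t ih =>
    set A := Algebra.adjoin ℤ (α '' Set.Iio (t + 1)) with hA
    have hsub : Algebra.adjoin ℤ (α '' Set.Iio t) ≤ A :=
      Algebra.adjoin_mono (Set.image_mono (Set.Iio_subset_Iio t.le_succ))
    obtain ⟨N, hN, hN'⟩ := exists_batch_expectation M
    choose K hK hK' using exists_descend (p := p) (p₁ := p₁) (p₂ := p₂) (a := a) (n := n) A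
      (Algebra.subset_adjoin ⟨t, Set.mem_Iio.2 t.lt_succ_self, rfl⟩ : α t ∈ A)
    choose L hL hL' using ih
    -- The newest mini-batch is eliminated by `N`, the last descent step is expanded by `K`, and the
    -- induction hypothesis `L` treats the result. The same functional `E` is used throughout, so no
    -- intermediate conditioning is needed.
    refine ⟨N.flatMap fun s => (K s.2.2).flatMap fun u => (L u.2).map fun v =>
      (s.1 * u.1 * v.1, s.2.1 + v.2.1, v.2.2), ?_, ?_⟩
    · intro x hx
      obtain ⟨s, hs, u, hu, v, hv, rfl⟩ := by
        simpa only [List.mem_flatMap, List.mem_map] using hx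
      obtain ⟨hs1, hs2, hs3⟩ := hN s hs
      obtain ⟨hu1, hu2⟩ := hK s.2.2 u hu
      obtain ⟨hv1, hv2, hv3⟩ := hL u.2 v hv
      refine ⟨A.mul_mem (A.mul_mem (bot_le (a := A) hs1) hu1) (hsub hv1), ?_, ?_⟩
      · have h1 := hu2.trans hs3
        set e := StepTraceProduct.gradDegree u.2
        set f := StepTraceProduct.studentDegree u.2
        calc s.2.1 + v.2.1 ≤ M.gradDegree +
              (geomThree (t + 1) * e + geomThree t * f) := add_le_add hs2 hv2
          -- The smaller coefficient is enlarged because the descent step bounds only the sum `e +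
          -- f`.
          _ ≤ M.gradDegree + (geomThree (t + 1) * e + geomThree (t + 1) * f) := by
            have : geomThree t ≤ geomThree (t + 1) := by
              rw [geomThree_succ]
              omega
            gcongr
          _ = M.gradDegree + geomThree (t + 1) * (e + f) := by ring
          _ ≤ M.gradDegree + geomThree (t + 1) * (3 * M.gradDegree + M.studentDegree) := by
            gcongr
          _ = geomThree (t + 1 + 1) * M.gradDegree + geomThree (t + 1) * M.studentDegree := by
            rw [geomThree_succ (t + 1)]
            ring
      · have h1 := hu2.trans hs3
        calc WeightTraceProduct.totalDegree v.2.2 ≤ 3 ^ t *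
              (3 * StepTraceProduct.gradDegree u.2 + StepTraceProduct.studentDegree u.2) := hv3
          _ ≤ 3 ^ t * (3 * (3 * M.gradDegree + M.studentDegree)) := by
            gcongr
            omega
          _ = 3 ^ (t + 1) * (3 * M.gradDegree + M.studentDegree) := by ring
    · intro R _ _ β G Δ S W₀ E h hE hG hS i j
      rw [hN' R β (G (t + 1)) (Δ (t + 1)) S _ E (h _) (hker R G Δ S W₀ hG hS (t + 1)) (hE _) i j,
        List.sum_flatMap_map]
      congr 2
      funext s
      rw [sgdIn, hK' s.2.2 R, Matrix.list_sum_map_apply, map_list_sum, List.map_map,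
        List.sum_flatMap_map, ← List.sum_map_mul_left]
      congr 2
      funext u
      rw [Function.comp_apply, Matrix.smul_apply, map_smul, smul_eq_mul,
        hL' u.2 R β G Δ S W₀ E h hE hG hS i j, ← List.sum_map_mul_left, ← List.sum_map_mul_left,
        List.map_map]
      congr 2
      funext v
      simp only [Function.comp_apply, pow_add]
      ring

end Iteration

/-! ### Gaussian integration by parts on polynomials in the samples. -/

section GaussianPolynomials

/-- A linear functional on polynomials that satisfies the integration by parts formula of
independent standard Gaussian variables. -/
structure IsGaussianFunctional {σ : Type} (E : MvPolynomial σ ℝ →ₗ[ℝ] ℝ) : Prop where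
  map_one : E 1 = 1
  map_X_mul : ∀ s P, E (MvPolynomial.X s * P) = E (MvPolynomial.pderiv s P)

variable {b p : ℕ}

/-- The Gram matrix of the mini-batch in step `t`, as a matrix of polynomials in the samples. -/
noncomputable def polyGram (b p t : ℕ) :
    Matrix (Fin p) (Fin p) (MvPolynomial ((ℕ × Fin b) × Fin p) ℝ) :=
  Matrix.of fun k l => (1 / (b : ℝ)) •
    ∑ i, MvPolynomial.X ((t, i), k) * MvPolynomial.X ((t, i), l)

/-- The derivations that express integration by parts for `polyGram`. -/
noncomputable def polyGramDerivation (b p t : ℕ) (k l : Fin p) :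
    Derivation ℝ (MvPolynomial ((ℕ × Fin b) × Fin p) ℝ)
      (MvPolynomial ((ℕ × Fin b) × Fin p) ℝ) :=
  ∑ i, (MvPolynomial.X ((t, i), l) : MvPolynomial ((ℕ × Fin b) × Fin p) ℝ) •
    MvPolynomial.pderiv ((t, i), k)

theorem polyGramDerivation_apply (t : ℕ) (k l : Fin p)
    (P : MvPolynomial ((ℕ × Fin b) × Fin p) ℝ) :
    polyGramDerivation b p t k l P =
      ∑ i, MvPolynomial.X ((t, i), l) * MvPolynomial.pderiv ((t, i), k) P := by
  have h := congrFun (map_sum (Derivation.coeFnAddMonoidHom (R := ℝ)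
    (A := MvPolynomial ((ℕ × Fin b) × Fin p) ℝ) (M := MvPolynomial ((ℕ × Fin b) × Fin p) ℝ))
    (fun i : Fin b => (MvPolynomial.X ((t, i), l) : MvPolynomial ((ℕ × Fin b) × Fin p) ℝ) •
      MvPolynomial.pderiv ((t, i), k)) Finset.univ) P
  rw [Finset.sum_apply] at h
  exact h

theorem polyGramDerivation_X (t u : ℕ) (k l v : Fin p) (i : Fin b) :
    polyGramDerivation b p t k l (MvPolynomial.X ((u, i), v)) =
      if t = u ∧ k = v then MvPolynomial.X ((t, i), l) else 0 := by
  rw [polyGramDerivation_apply]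
  simp only [MvPolynomial.pderiv_X, Pi.single_apply, Prod.mk.injEq, mul_ite, mul_one, mul_zero]
  rw [Finset.sum_eq_single i]
  · by_cases h : t = u ∧ k = v
    · simp [h.1, h.2]
    · rw [if_neg h, if_neg]
      rintro ⟨⟨h1, -⟩, h2⟩
      exact h ⟨h1.symm, h2.symm⟩
  · intro j _ hj
    rw [if_neg]
    rintro ⟨⟨-, h1⟩, -⟩
    exact hj h1.symm
  · simp

theorem polyGram_symm (t : ℕ) : (polyGram b p t)ᵀ = polyGram b p t := by
  ext k l
  simp only [polyGram, Matrix.transpose_apply, Matrix.of_apply, mul_comm]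

/-- Two step indices serve two purposes: for `t = u` this is the tangent formula, and for `t ≠ u` it
says that the derivations of one mini-batch annihilate the Gram matrix of another. -/
theorem polyGramDerivation_polyGram (t u : ℕ) (k l v w : Fin p) :
    polyGramDerivation b p t k l (polyGram b p u v w) =
      (if t = u ∧ k = v then polyGram b p t l w else 0) +
        if t = u ∧ k = w then polyGram b p t v l else 0 := by
  simp only [polyGram, Matrix.of_apply, Derivation.map_smul, map_sum, Derivation.leibniz,
    polyGramDerivation_X, smul_eq_mul, Finset.sum_add_distrib, smul_add]
  rw [add_comm]
  congr 1
  · split_ifs with h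
    · rw [h.1]
      simp only [mul_comm]
    · simp
  · split_ifs with h
    · rw [h.1]
    · simp

theorem isGramDerivation_polyGram (t : ℕ) :
    IsGramDerivation (polyGram b p t) (polyGramDerivation b p t) where
  symm := polyGram_symm t
  apply_gram k l := by
    ext v w : 1
    rw [Matrix.map_apply, polyGramDerivation_polyGram, gramTangent, Matrix.add_apply,
      Matrix.mul_apply, Matrix.mul_apply]
    congr 1
    · simp [Matrix.single_apply, ite_and]
    · simp only [Matrix.single_apply, ite_and, true_and, mul_ite, mul_one, mul_zero]
      simp

/-- Integrating $x_{i,k}$ by parts in $x_{i,k}x_{i,l}\Phi$ gives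
$\delta_{kl}\Phi+x_{i,l}\,\partial_{x_{i,k}}\Phi$. The average over $i$ keeps $\delta_{kl}$, which
needs $b\ne0$, and puts $1/b$ before the derivation. -/
theorem IsGaussianFunctional.isGramFunctional {E : MvPolynomial ((ℕ × Fin b) × Fin p) ℝ →ₗ[ℝ] ℝ}
    (hE : IsGaussianFunctional E) (hb : 1 ≤ b) (t : ℕ) :
    IsGramFunctional (1 / (b : ℝ)) (polyGram b p t) (polyGramDerivation b p t) E := by
  intro k l Φ
  have hb' : (b : ℝ) ≠ 0 := by positivity
  have h : ∀ i : Fin b, E (MvPolynomial.X ((t, i), k) * MvPolynomial.X ((t, i), l) * Φ) =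
      (if k = l then E Φ else 0) +
        E (MvPolynomial.X ((t, i), l) * MvPolynomial.pderiv ((t, i), k) Φ) := by
    intro i
    rw [mul_assoc, hE.map_X_mul, Derivation.leibniz, map_add, add_comm, MvPolynomial.pderiv_X,
      Pi.single_apply]
    simp only [Prod.mk.injEq, true_and, smul_eq_mul, eq_comm (a := l)]
    split_ifs <;> simp
  rw [polyGram, Matrix.of_apply, smul_mul_assoc, map_smul, Finset.sum_mul, map_sum,
    polyGramDerivation_apply, map_sum, smul_eq_mul]
  simp only [h, Finset.sum_add_distrib, mul_add]
  congr 1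
  simp [hb']

end GaussianPolynomials

/-! ### Compatibility with algebra homomorphisms, and the link to the actual SGD. -/

section Naturality

/-- Apply a function to all entries of the weights. -/
def WeightsIn.map {p p₁ p₂ : ℕ} {R R' : Type*} (f : R → R') (W : WeightsIn R p p₁ p₂) : WeightsIn R' p p₁ p₂ :=
  (W.1.map f, W.2.map f)

theorem weightValueIn_map {p p₁ p₂ : ℕ} {R R' : Type*} (f : R → R') (S W : WeightsIn R p p₁ p₂) :
    (fun s => (weightValueIn S W s).map f) =
      weightValueIn (WeightsIn.map f S) (WeightsIn.map f W) := by
  funext s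
  cases s <;> rfl

variable {p p₁ p₂ : ℕ} {R R' : Type*} [CommRing R] [Algebra ℝ R] [CommRing R'] [Algebra ℝ R']

theorem gradIn₁_map (f : R →ₐ[ℝ] R') (S W : WeightsIn R p p₁ p₂) (G : Matrix (Fin p) (Fin p) R) :
    (gradIn₁ S W G).map f = gradIn₁ (WeightsIn.map f S) (WeightsIn.map f W) (G.map f) := by
  simp [gradIn₁, WeightsIn.map, Matrix.map_mul, Matrix.map_sub, Matrix.transpose_map]

theorem gradIn₂_map (f : R →ₐ[ℝ] R') (S W : WeightsIn R p p₁ p₂) (G : Matrix (Fin p) (Fin p) R) :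
    (gradIn₂ S W G).map f = gradIn₂ (WeightsIn.map f S) (WeightsIn.map f W) (G.map f) := by
  simp [gradIn₂, WeightsIn.map, Matrix.map_mul, Matrix.map_sub, Matrix.transpose_map]

theorem stepValueIn_map (f : R →ₐ[ℝ] R') (S W : WeightsIn R p p₁ p₂)
    (G : Matrix (Fin p) (Fin p) R) :
    (fun s => (stepValueIn S W G s).map f) =
      stepValueIn (WeightsIn.map f S) (WeightsIn.map f W) (G.map f) := by
  funext s
  cases s
  exacts [gradIn₁_map f S W G, gradIn₂_map f S W G, rfl, rfl, rfl, rfl]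

theorem sgdIn_map (f : R →ₐ[ℝ] R') (α : ℕ → ℝ) (S W₀ : WeightsIn R p p₁ p₂)
    (G : ℕ → Matrix (Fin p) (Fin p) R) (t : ℕ) :
    WeightsIn.map f (sgdIn α S W₀ G t) =
      sgdIn α (WeightsIn.map f S) (WeightsIn.map f W₀) (fun u => (G u).map f) t := by
  induction t with
  | zero => rfl
  | succ t ih =>
    rw [sgdIn, sgdIn, ← ih, descendIn, descendIn, ← gradIn₁_map, ← gradIn₂_map]
    ext i j <;> simp [WeightsIn.map]

/-- All operations are polynomial in the matrix entries. This serves both to evaluate polynomials at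
samples and to evaluate random variables at points. -/
theorem TraceProduct.evalIn_sgdIn_map (f : R →ₐ[ℝ] R') (α : ℕ → ℝ) (S W₀ : WeightsIn R p p₁ p₂)
    (G : ℕ → Matrix (Fin p) (Fin p) R) (t : ℕ) {a n : ℕ} (M : StepTraceProduct p p₁ p₂ a n)
    (i : Fin a) (j : Fin n) :
    f (TraceProduct.evalIn (stepValueIn S (sgdIn α S W₀ G t) (G t)) M i j) =
      TraceProduct.evalIn (stepValueIn (WeightsIn.map f S)
        (sgdIn α (WeightsIn.map f S) (WeightsIn.map f W₀) (fun u => (G u).map f) t)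
        ((G t).map f)) M i j := by
  rw [← sgdIn_map, ← stepValueIn_map]
  exact congrFun (congrFun (TraceProduct.evalIn_map (f : R →+* R') _ M) i) j

/-- The Gram matrix of a mini-batch. -/
noncomputable def sampleGram {b : ℕ} (x : Fin b → EuclideanSpace ℝ (Fin p)) :
    Matrix (Fin p) (Fin p) ℝ :=
  (1 / (b : ℝ)) • ∑ i, Matrix.vecMulVec (x i).ofLp (x i).ofLp

theorem batchGrad₁_eq {b : ℕ} (S W : Weights p p₁ p₂) (x : Fin b → EuclideanSpace ℝ (Fin p)) :
    batchGrad₁ S W x = gradIn₁ S W (sampleGram x) := by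
  simp only [batchGrad₁, sampleGrad₁_eq, gradIn₁, sampleGram, Matrix.mul_smul, Matrix.mul_sum]

theorem batchGrad₂_eq {b : ℕ} (S W : Weights p p₁ p₂) (x : Fin b → EuclideanSpace ℝ (Fin p)) :
    batchGrad₂ S W x = gradIn₂ S W (sampleGram x) := by
  simp only [batchGrad₂, sampleGrad₂_eq, gradIn₂, sampleGram, Matrix.mul_smul, Matrix.smul_mul,
    Matrix.mul_sum, Matrix.sum_mul]

theorem sgd_eq_sgdIn {b : ℕ} (α : ℕ → ℝ) (S W₀ : Weights p p₁ p₂)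
    (x : ℕ → Fin b → EuclideanSpace ℝ (Fin p)) (t : ℕ) :
    sgd α S W₀ x t = sgdIn α S W₀ (fun u => sampleGram (x u)) t := by
  induction t with
  | zero => rfl
  | succ t ih => rw [sgd, sgdIn, ← ih, descendIn, batchGrad₁_eq, batchGrad₂_eq]

theorem weightValue_eq_weightValueIn (S W : Weights p p₁ p₂) :
    weightValue S W = weightValueIn S W := by
  funext s
  cases s <;> rfl

theorem stepValue_eq_stepValueIn {b : ℕ} (S W : Weights p p₁ p₂)
    (x : Fin b → EuclideanSpace ℝ (Fin p)) :
    stepValue S W x = stepValueIn S W (sampleGram x) := by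
  funext s
  cases s
  exacts [batchGrad₁_eq S W x, batchGrad₂_eq S W x, rfl, rfl, rfl, rfl]

/-- The value of a trace product after `t` steps for given initial weights and samples. -/
noncomputable def stepEval {b a n : ℕ} (M : StepTraceProduct p p₁ p₂ a n) (α : ℕ → ℝ)
    (S : Weights p p₁ p₂) (t : ℕ) (W₀ : Weights p p₁ p₂)
    (x : ℕ → Fin b → EuclideanSpace ℝ (Fin p)) : Matrix (Fin a) (Fin n) ℝ :=
  TraceProduct.evalIn (stepValueIn S (sgdIn α S W₀ (fun u => sampleGram (x u)) t)
    (sampleGram (x t))) M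

theorem StepTraceProduct.atStep_eq {b a n : ℕ} (M : StepTraceProduct p p₁ p₂ a n) {Ω : Type*}
    (α : ℕ → ℝ) (S : Weights p p₁ p₂) (W₀ : Ω → Weights p p₁ p₂)
    (x : ℕ → Fin b → Ω → EuclideanSpace ℝ (Fin p)) (t : ℕ) (ω : Ω) :
    M.atStep α S W₀ x t ω = stepEval M α S t (W₀ ω) fun u k => x u k ω := by
  rw [StepTraceProduct.atStep, TraceProduct.eval_eq_evalIn, stepValue_eq_stepValueIn,
    sgd_eq_sgdIn]
  rfl

/-- The value of a trace product after `t` steps, as a polynomial in the samples. -/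
noncomputable def stepPoly {a n : ℕ} (b : ℕ) (M : StepTraceProduct p p₁ p₂ a n) (α : ℕ → ℝ)
    (S : Weights p p₁ p₂) (t : ℕ) (W₀ : Weights p p₁ p₂) :
    Matrix (Fin a) (Fin n) (MvPolynomial ((ℕ × Fin b) × Fin p) ℝ) :=
  TraceProduct.evalIn (stepValueIn (WeightsIn.map MvPolynomial.C S)
    (sgdIn α (WeightsIn.map MvPolynomial.C S) (WeightsIn.map MvPolynomial.C W₀)
      (polyGram b p) t) (polyGram b p t)) M

theorem eval_stepPoly {b a n : ℕ} (M : StepTraceProduct p p₁ p₂ a n) (α : ℕ → ℝ)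
    (S : Weights p p₁ p₂) (t : ℕ) (W₀ : Weights p p₁ p₂)
    (x : ℕ → Fin b → EuclideanSpace ℝ (Fin p)) (i : Fin a) (j : Fin n) :
    MvPolynomial.eval (fun s : (ℕ × Fin b) × Fin p => x s.1.1 s.1.2 s.2) (stepPoly b M α S t W₀ i j) =
      stepEval M α S t W₀ x i j := by
  have h := TraceProduct.evalIn_sgdIn_map
    (MvPolynomial.aeval fun s : (ℕ × Fin b) × Fin p => x s.1.1 s.1.2 s.2)
    α (WeightsIn.map MvPolynomial.C S) (WeightsIn.map MvPolynomial.C W₀) (polyGram b p) t M i j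
  have hC : ∀ W : Weights p p₁ p₂, WeightsIn.map
      (MvPolynomial.aeval (R := ℝ) fun s : (ℕ × Fin b) × Fin p => x s.1.1 s.1.2 s.2)
      (WeightsIn.map MvPolynomial.C W) = W := fun W => by
    ext k l <;> simp [WeightsIn.map]
  have hG : ∀ u, (polyGram b p u).map
      (MvPolynomial.aeval (R := ℝ) fun s : (ℕ × Fin b) × Fin p => x s.1.1 s.1.2 s.2) =
      sampleGram (x u) := fun u => by
    ext k l
    simp [polyGram, sampleGram, Matrix.sum_apply, Matrix.vecMulVec_apply]
  simp only [hC, hG] at h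
  rw [stepEval, ← h]
  exact (DFunLike.congr_fun (MvPolynomial.coe_aeval_eq_eval _) _).symm

end Naturality

/-- The formal expansion is applied to polynomials in the samples, in which the initial weights and
the teacher are constants. The terms that remain are constant polynomials, which `E` sends to their
values. -/
theorem IsGaussianFunctional.exists_expectation {p p₁ p₂ : ℕ} (α : ℕ → ℝ) (t : ℕ) {a n : ℕ}
    (M : StepTraceProduct p p₁ p₂ a n) :
    ∃ N : List (ℝ × ℕ × WeightTraceProduct p p₁ p₂ a n),
      (∀ s ∈ N, s.1 ∈ Algebra.adjoin ℤ (α '' Set.Iio t) ∧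
        s.2.1 ≤ geomThree (t + 1) * M.gradDegree + geomThree t * M.studentDegree ∧
        WeightTraceProduct.totalDegree s.2.2 ≤
          3 ^ t * (3 * M.gradDegree + M.studentDegree)) ∧
      ∀ (b : ℕ), 1 ≤ b → ∀ (S W₀ : Weights p p₁ p₂)
        (E : MvPolynomial ((ℕ × Fin b) × Fin p) ℝ →ₗ[ℝ] ℝ), IsGaussianFunctional E →
        ∀ i j, E (stepPoly b M α S t W₀ i j) =
          (N.map fun s => s.1 * (1 / (b : ℝ)) ^ s.2.1 *
            s.2.2.eval (weightValue S W₀) i j).sum := by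
  obtain ⟨N, hN, hN'⟩ := exists_sgd_expectation α t M
  refine ⟨N, hN, fun b hb S W₀ E hE i j => ?_⟩
  rw [stepPoly, hN' _ (1 / (b : ℝ)) (polyGram b p) (polyGramDerivation b p)
    (WeightsIn.map MvPolynomial.C S) (WeightsIn.map MvPolynomial.C W₀) E
    isGramDerivation_polyGram (hE.isGramFunctional hb) ?_ ?_ i j]
  · congr 2
    funext s
    congr 1
    have h := congrFun (congrFun (TraceProduct.evalIn_map
      (MvPolynomial.C (σ := (ℕ × Fin b) × Fin p) (R := ℝ)) (weightValueIn S W₀) s.2.2) i) j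
    rw [Matrix.map_apply, weightValueIn_map] at h
    rw [← h, TraceProduct.eval_eq_evalIn, weightValue_eq_weightValueIn, ← mul_one (MvPolynomial.C _),
      ← MvPolynomial.smul_eq_C_mul, map_smul, hE.map_one, smul_eq_mul, mul_one]
  · intro u v huv i j k l
    rw [polyGramDerivation_polyGram, if_neg fun h => huv.ne' h.1, if_neg fun h => huv.ne' h.1,
      add_zero]
  · intro u s i j k l
    rw [← weightValueIn_map]
    exact (polyGramDerivation b p u k l).map_algebraMap (weightValueIn S W₀ s i j)

/-! ### Moments of the standard Gaussian on the line. -/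

section GaussianMoments

theorem integrable_pow_gaussianReal (n : ℕ) : Integrable (fun x : ℝ => x ^ n) (gaussianReal 0 1) := by
  have h := (memLp_id_gaussianReal' (μ := 0) (v := 1) (n : ENNReal)
    (ENNReal.natCast_ne_top n)).integrable_norm_pow'
  refine (integrable_norm_iff (by fun_prop)).1 (h.congr (ae_of_all _ fun x => ?_))
  simp

theorem hasDerivAt_gaussianPDFReal (x : ℝ) :
    HasDerivAt (gaussianPDFReal 0 1) (-(x * gaussianPDFReal 0 1 x)) x := by
  have h1 : HasDerivAt (fun x : ℝ => -(x - 0) ^ 2 / (2 * ((1 : NNReal) : ℝ))) (-x) x := by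
    have h2 := (((hasDerivAt_id x).sub_const 0).pow 2).neg.div_const (2 * ((1 : NNReal) : ℝ))
    refine h2.congr_deriv ?_
    simp
    ring
  have h3 := (h1.exp).const_mul (√(2 * Real.pi * ((1 : NNReal) : ℝ)))⁻¹
  refine h3.congr_deriv ?_
  rw [gaussianPDFReal]
  ring

theorem integrable_pow_mul_gaussianPDFReal (n : ℕ) :
    Integrable fun x : ℝ => x ^ n * gaussianPDFReal 0 1 x := by
  have h := integrable_pow_gaussianReal n
  rw [gaussianReal_of_var_ne_zero 0 one_ne_zero, integrable_withDensity_iff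
    (measurable_gaussianPDF 0 1) (ae_of_all _ fun x => gaussianPDF_lt_top)] at h
  simpa [toReal_gaussianPDF] using h

/-- The recursion of the moments of the standard Gaussian distribution. -/
theorem integral_pow_succ_gaussianReal (n : ℕ) :
    ∫ x, x ^ (n + 1) ∂gaussianReal 0 1 = n * ∫ x, x ^ (n - 1) ∂gaussianReal 0 1 := by
  -- Integration by parts of $x^n$ against $\varphi'=-x\varphi$. For `n = 0` the truncated exponent
  -- `n - 1` is harmless, since its factor is zero.
  have h := integral_mul_deriv_eq_deriv_mul_of_integrable
    (u := fun x : ℝ => x ^ n) (u' := fun x : ℝ => n * x ^ (n - 1))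
    (v := gaussianPDFReal 0 1) (v' := fun x => -(x * gaussianPDFReal 0 1 x))
    (fun x _ => hasDerivAt_pow n x) (fun x _ => hasDerivAt_gaussianPDFReal x)
    ((integrable_pow_mul_gaussianPDFReal (n + 1)).neg.congr (ae_of_all _ fun x => by
      simp only [Pi.neg_apply, Pi.mul_apply]
      ring))
    (((integrable_pow_mul_gaussianPDFReal (n - 1)).const_mul n).congr (ae_of_all _ fun x => by
      simp only [Pi.mul_apply]
      ring))
    (integrable_pow_mul_gaussianPDFReal n)
  rw [integral_gaussianReal_eq_integral_smul one_ne_zero,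
    integral_gaussianReal_eq_integral_smul one_ne_zero, ← integral_const_mul]
  rw [← neg_inj, ← integral_neg, neg_neg] at h
  convert h using 1
  · congr 1
    funext x
    simp only [smul_eq_mul]
    ring
  · congr 1
    funext x
    simp only [smul_eq_mul]
    ring

end GaussianMoments

/-! ### Random variables with finite moments of all orders. -/

section Moments

theorem aeval_mem_subalgebra {σ R : Type*} [CommRing R] [Algebra ℝ R] {A : Subalgebra ℝ R}
    {Z : σ → R} (hZ : ∀ s, Z s ∈ A) (P : MvPolynomial σ ℝ) : MvPolynomial.aeval Z P ∈ A := by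
  induction P using MvPolynomial.induction_on with
  | C a => exact (MvPolynomial.aeval_C Z a) ▸ A.algebraMap_mem a
  | add P Q hP hQ => exact (map_add (MvPolynomial.aeval Z) P Q) ▸ A.add_mem hP hQ
  | mul_X P s hP =>
    rw [map_mul, MvPolynomial.aeval_X]
    exact A.mul_mem hP (hZ s)

theorem aeval_pi_apply {Ω σ : Type*} (Z : σ → Ω → ℝ) (P : MvPolynomial σ ℝ) (ω : Ω) :
    MvPolynomial.aeval Z P ω = MvPolynomial.eval (fun s => Z s ω) P := by
  induction P using MvPolynomial.induction_on with
  | C a => simp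
  | add P Q hP hQ => simp [hP, hQ]
  | mul_X P s hP => simp [hP]

variable {Ω : Type*} [MeasurableSpace Ω] (μ : Measure Ω) [IsFiniteMeasure μ]

/-- The algebra of random variables with finite moments of all orders. -/
def momentSubalgebra : Subalgebra ℝ (Ω → ℝ) where
  carrier := {f | AEStronglyMeasurable f μ ∧ ∀ r : ℕ, Integrable (fun ω => |f ω| ^ r) μ}
  mul_mem' {f g} hf hg := by
    refine ⟨hf.1.mul hg.1, fun r => ?_⟩
    refine ((hf.2 (2 * r)).add (hg.2 (2 * r))).mono' ?_ (ae_of_all _ fun ω => ?_)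
    · exact (hf.1.mul hg.1).norm.pow r
    · simp only [Pi.mul_apply, Pi.add_apply, Real.norm_eq_abs, abs_pow, abs_abs, abs_mul, mul_pow,
        pow_mul']
      nlinarith [sq_nonneg (|f ω| ^ r - |g ω| ^ r), sq_nonneg (|f ω| ^ r + |g ω| ^ r)]
  add_mem' {f g} hf hg := by
    refine ⟨hf.1.add hg.1, fun r => ?_⟩
    refine (((hf.2 r).add (hg.2 r)).const_mul (2 ^ (r - 1))).mono' ?_ (ae_of_all _ fun ω => ?_)
    · exact (hf.1.add hg.1).norm.pow r
    · simp only [Pi.add_apply, Real.norm_eq_abs, abs_pow, abs_abs]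
      exact (pow_le_pow_left₀ (abs_nonneg _) (abs_add_le _ _) r).trans
        (add_pow_le (abs_nonneg _) (abs_nonneg _) r)
  algebraMap_mem' x := ⟨aestronglyMeasurable_const, fun r => integrable_const (|x| ^ r)⟩

variable {μ}

theorem integrable_of_mem_momentSubalgebra {f : Ω → ℝ} (hf : f ∈ momentSubalgebra μ) :
    Integrable f μ :=
  (integrable_norm_iff hf.1).1 (by simpa using hf.2 1)

/-- The expectation of polynomials in random variables with finite moments. -/
noncomputable def polyExpectation {σ : Type} (Z : σ → Ω → ℝ) (hZ : ∀ s, Z s ∈ momentSubalgebra μ) :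
    MvPolynomial σ ℝ →ₗ[ℝ] ℝ where
  toFun P := ∫ ω, MvPolynomial.eval (fun s => Z s ω) P ∂μ
  map_add' P Q := by
    simp only [← aeval_pi_apply, map_add]
    exact integral_add (integrable_of_mem_momentSubalgebra (aeval_mem_subalgebra hZ P))
      (integrable_of_mem_momentSubalgebra (aeval_mem_subalgebra hZ Q))
  map_smul' c P := by
    simp only [MvPolynomial.smul_eval, RingHom.id_apply, smul_eq_mul, integral_const_mul]

end Moments

/-! ### Independent standard Gaussians satisfy integration by parts on polynomials. -/

section StandardGaussian

variable {Ω : Type*} [MeasurableSpace Ω] {μ : Measure Ω}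

theorem map_coord_stdGaussian {p : ℕ} (j : Fin p) :
    (stdGaussian (EuclideanSpace ℝ (Fin p))).map (fun x => x j) = gaussianReal 0 1 := by
  rw [← map_pi_eq_stdGaussian, Measure.map_map (by fun_prop) (by fun_prop)]
  exact (measurePreserving_eval (fun _ : Fin p => gaussianReal 0 1) j).map_eq

theorem iIndepFun_coord_stdGaussian (p : ℕ) :
    iIndepFun (fun (j : Fin p) (x : EuclideanSpace ℝ (Fin p)) => x j)
      (stdGaussian (EuclideanSpace ℝ (Fin p))) := by
  have h := iIndepFun_pi (μ := fun _ : Fin p => gaussianReal 0 1) (X := fun _ x => x)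
    fun _ => aemeasurable_id
  rw [iIndepFun_iff_map_fun_eq_pi_map (fun j => by fun_prop)]
  simp only [map_coord_stdGaussian]
  rw [← map_pi_eq_stdGaussian, Measure.map_map (by fun_prop) (by fun_prop)]
  exact Measure.map_id

theorem mem_momentSubalgebra_of_map_eq [IsFiniteMeasure μ] {f : Ω → ℝ} (hf : Measurable f)
    (h : μ.map f = gaussianReal 0 1) : f ∈ momentSubalgebra μ := by
  refine ⟨hf.aestronglyMeasurable, fun r => ?_⟩
  have h1 := (integrable_pow_gaussianReal r).norm
  rw [← h, integrable_map_measure (by fun_prop) hf.aemeasurable] at h1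
  refine h1.congr (ae_of_all _ fun ω => ?_)
  simp

variable {σ : Type} {Z : σ → Ω → ℝ}

/-- Independence factors the expectation. The set `T` may exceed the support so that monomials with
different supports can be compared over one index set; the extra factors are zeroth moments. -/
theorem integral_eval_monomial [IsProbabilityMeasure μ] (hZ : ∀ s, Measurable (Z s))
    (hlaw : ∀ s, μ.map (Z s) = gaussianReal 0 1) (hindep : iIndepFun Z μ) (d : σ →₀ ℕ) (c : ℝ)
    (T : Finset σ) (hT : d.support ⊆ T) :
    ∫ ω, MvPolynomial.eval (fun s => Z s ω) (MvPolynomial.monomial d c) ∂μ =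
      c * ∏ s ∈ T, ∫ x, x ^ d s ∂gaussianReal 0 1 := by
  have hT' : iIndepFun (fun s : T => Z s) μ := hindep.precomp Subtype.val_injective
  have h := hT'.integral_fun_prod_comp (f := fun (s : T) x => x ^ d s)
    (fun s => (hZ s).aemeasurable) fun s => by fun_prop
  have h1 : ∀ ω, MvPolynomial.eval (fun s => Z s ω) (MvPolynomial.monomial d c) =
      c * ∏ s : T, Z s ω ^ d s := fun ω => by
    rw [MvPolynomial.eval_monomial, Finsupp.prod_of_support_subset d hT _ fun i _ => pow_zero _,
      Finset.prod_coe_sort T fun s => Z s ω ^ d s]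
  have h2 : ∀ s, ∫ ω, Z s ω ^ d s ∂μ = ∫ x, x ^ d s ∂gaussianReal 0 1 := fun s => by
    rw [← hlaw s, integral_map (hZ s).aemeasurable (by fun_prop)]
  simp only [h1, integral_const_mul]
  rw [← Finset.prod_coe_sort T fun s => ∫ x, x ^ d s ∂gaussianReal 0 1]
  simp only [← h2]
  congr 1

/-- By linearity monomials suffice. There the formula is the moment recursion in the variable `s`,
while all other factors agree. -/
theorem isGaussianFunctional_polyExpectation [IsProbabilityMeasure μ] (hZ : ∀ s, Measurable (Z s))
    (hlaw : ∀ s, μ.map (Z s) = gaussianReal 0 1) (hindep : iIndepFun Z μ)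
    (hmem : ∀ s, Z s ∈ momentSubalgebra μ) : IsGaussianFunctional (polyExpectation Z hmem) where
  map_one := by simp [polyExpectation]
  map_X_mul s P := by
    classical
    induction P using MvPolynomial.induction_on' with
    | add P Q hP hQ => rw [mul_add, map_add, map_add, map_add, hP, hQ]
    | monomial d c =>
      rw [MvPolynomial.X, MvPolynomial.monomial_mul, one_mul, MvPolynomial.pderiv_monomial]
      change ∫ ω, _ ∂μ = ∫ ω, _ ∂μ
      -- `insert s d.support` contains the supports of both monomials, and also `s` itself when `s`
      -- does not occur in `d`.
      have hT1 : (Finsupp.single s 1 + d).support ⊆ insert s d.support := by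
        intro i hi
        by_contra h
        simp only [Finset.mem_insert, Finsupp.mem_support_iff, not_or, not_not] at h
        simp [h.2, Ne.symm h.1] at hi
      have hT2 : (d - Finsupp.single s 1).support ⊆ insert s d.support := by
        intro i hi
        by_contra h
        simp only [Finset.mem_insert, Finsupp.mem_support_iff, not_or, not_not] at h
        simp [h.2] at hi
      rw [integral_eval_monomial hZ hlaw hindep _ _ _ hT1,
        integral_eval_monomial hZ hlaw hindep _ _ _ hT2,
        ← Finset.mul_prod_erase _ _ (Finset.mem_insert_self s d.support),
        ← Finset.mul_prod_erase _ _ (Finset.mem_insert_self s d.support)]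
      have h1 : ∀ i ∈ (insert s d.support).erase s,
          (Finsupp.single s 1 + d : σ →₀ ℕ) i = (d - Finsupp.single s 1 : σ →₀ ℕ) i := by
        intro i hi
        simp [Ne.symm (Finset.ne_of_mem_erase hi)]
      rw [Finset.prod_congr rfl fun i hi => by rw [h1 i hi]]
      have h2 := integral_pow_succ_gaussianReal (d s)
      simp only [Finsupp.add_apply, Finsupp.tsub_apply, Finsupp.single_eq_same, add_comm 1, h2]
      ring

end StandardGaussian

/-! ### The coordinates of the online samples. -/

section OnlineSample

variable {Ω : Type*} [MeasurableSpace Ω] {μ : Measure Ω} {p p₁ p₂ b : ℕ}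
  {W₀ : Ω → Weights p p₁ p₂} {x : ℕ → Fin b → Ω → EuclideanSpace ℝ (Fin p)}

/-- The coordinates of the samples. -/
def sampleCoord (x : ℕ → Fin b → Ω → EuclideanSpace ℝ (Fin p)) :
    (ℕ × Fin b) × Fin p → Ω → ℝ :=
  fun s ω => x s.1.1 s.1.2 ω s.2

theorem IsOnlineSample.measurable_sampleCoord (h : IsOnlineSample μ W₀ x) (s) :
    Measurable (sampleCoord x s) := by
  have := h.measurable_sample s.1.1 s.1.2
  unfold sampleCoord
  fun_prop

theorem IsOnlineSample.map_sampleCoord (h : IsOnlineSample μ W₀ x) (s) :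
    μ.map (sampleCoord x s) = gaussianReal 0 1 := by
  rw [← map_coord_stdGaussian (p := p) s.2, ← h.law_sample s.1.1 s.1.2,
    Measure.map_map (by fun_prop) (h.measurable_sample _ _)]
  rfl

/-- The samples are independent of each other, and the coordinates within a standard Gaussian vector
are independent; together this gives joint independence of all coordinates. -/
theorem IsOnlineSample.iIndepFun_sampleCoord (h : IsOnlineSample μ W₀ x) :
    iIndepFun (sampleCoord x) μ := by
  have h1 : iIndepFun (fun (ti : ℕ × Fin b) ω (j : Fin p) => x ti.1 ti.2 ω j) μ :=
    h.indep_sample.comp (fun _ (y : EuclideanSpace ℝ (Fin p)) (j : Fin p) => y j)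
      fun _ => by fun_prop
  refine iIndepFun_uncurry' (X := fun (ti : ℕ × Fin b) (j : Fin p) ω => x ti.1 ti.2 ω j)
    (fun ti j => h.measurable_sampleCoord (ti, j)) h1 fun ti => ?_
  have h2 := iIndepFun_coord_stdGaussian p
  have hm := h.measurable_sample ti.1 ti.2
  have := h1.isProbabilityMeasure
  have := Measure.isProbabilityMeasure_map (μ := μ) hm.aemeasurable
  rw [← h.law_sample ti.1 ti.2, iIndepFun_iff_map_fun_eq_pi_map (fun j => by fun_prop),
    Measure.map_map (by fun_prop) hm] at h2
  rw [iIndepFun_iff_map_fun_eq_pi_map (fun j => by fun_prop)]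
  refine h2.trans ?_
  congr 1
  funext j
  rw [Measure.map_map (by fun_prop) hm]
  rfl

variable [IsProbabilityMeasure μ]

theorem IsOnlineSample.sampleCoord_mem (h : IsOnlineSample μ W₀ x) (s) :
    sampleCoord x s ∈ momentSubalgebra μ :=
  mem_momentSubalgebra_of_map_eq (h.measurable_sampleCoord s) (h.map_sampleCoord s)

theorem IsOnlineSample.integral_stepEval (h : IsOnlineSample μ W₀ x) {a n : ℕ}
    (M : StepTraceProduct p p₁ p₂ a n) (α : ℕ → ℝ) (S W : Weights p p₁ p₂) (t : ℕ)
    (i : Fin a) (j : Fin n) :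
    ∫ ω, stepEval M α S t W (fun u k => x u k ω) i j ∂μ =
      polyExpectation (sampleCoord x) h.sampleCoord_mem (stepPoly b M α S t W i j) := by
  simp only [← eval_stepPoly]
  rfl

end OnlineSample

/-! ### Measurability and moments of the SGD expressions. -/

section Membership

variable {p p₁ p₂ b a n : ℕ}

/-- The whole computation is run in the ring of functions on `Θ`, where it stays in any subalgebra
containing its inputs. Evaluation at `θ` is an algebra homomorphism and returns the actual values.
-/
theorem stepEval_mem {Θ : Type*} {A : Subalgebra ℝ (Θ → ℝ)} (M : StepTraceProduct p p₁ p₂ a n)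
    (α : ℕ → ℝ) (S : Weights p p₁ p₂) (t : ℕ) (W : Θ → Weights p p₁ p₂)
    (y : Θ → ℕ → Fin b → EuclideanSpace ℝ (Fin p))
    (hW₁ : ∀ i j, (fun θ => (W θ).1 i j) ∈ A) (hW₂ : ∀ i j, (fun θ => (W θ).2 i j) ∈ A)
    (hy : ∀ t i j, (fun θ => y θ t i j) ∈ A) (i : Fin a) (j : Fin n) :
    (fun θ => stepEval M α S t (W θ) (y θ) i j) ∈ A := by
  let S' : WeightsIn (Θ → ℝ) p p₁ p₂ := WeightsIn.map (algebraMap ℝ (Θ → ℝ)) S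
  let W' : WeightsIn (Θ → ℝ) p p₁ p₂ :=
    (Matrix.of fun i j θ => (W θ).1 i j, Matrix.of fun i j θ => (W θ).2 i j)
  let G : ℕ → Matrix (Fin p) (Fin p) (Θ → ℝ) := fun u =>
    Matrix.of fun k l => (1 / (b : ℝ)) • ∑ i, (fun θ => y θ u i k) * fun θ => y θ u i l
  have hS' : ∀ s i j, weightValueIn S' W' s i j ∈ A := by
    intro s
    cases s
    exacts [hW₁, hW₂, fun i j => A.algebraMap_mem _, fun i j => A.algebraMap_mem _]
  have hG : ∀ u i j, G u i j ∈ A := fun u k l =>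
    A.smul_mem (A.sum_mem fun i _ => A.mul_mem (hy u i k) (hy u i l)) _
  have hmem : TraceProduct.evalIn (stepValueIn S' (sgdIn α S' W' G t) (G t)) M i j ∈ A :=
    TraceProduct.evalIn_mem (A := A.toSubring)
      (stepValueIn_mem (sgdIn_mem hS' t fun u _ => hG u) (hG t)) M i j
  convert hmem using 1
  funext θ
  have h := TraceProduct.evalIn_sgdIn_map (Pi.evalAlgHom ℝ (fun _ : Θ => ℝ) θ) α S' W' G t M i j
  have hS : WeightsIn.map (Pi.evalAlgHom ℝ (fun _ : Θ => ℝ) θ) S' = S := rfl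
  have hW : WeightsIn.map (Pi.evalAlgHom ℝ (fun _ : Θ => ℝ) θ) W' = W θ := rfl
  have hGθ : ∀ u, (G u).map (Pi.evalAlgHom ℝ (fun _ : Θ => ℝ) θ) = sampleGram (y θ u) :=
    fun u => by
      ext k l
      simp [G, sampleGram, Matrix.sum_apply, Matrix.vecMulVec_apply]
  simp only [hS, hW, hGθ] at h
  exact h.symm

/-- The algebra of measurable functions. -/
def measurableSubalgebra (Θ : Type*) [MeasurableSpace Θ] : Subalgebra ℝ (Θ → ℝ) where
  carrier := {f | Measurable f}
  mul_mem' hf hg := Measurable.mul hf hg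
  add_mem' hf hg := Measurable.add hf hg
  algebraMap_mem' _ := measurable_const

theorem measurable_entry {m n : ℕ} (i : Fin m) (j : Fin n) :
    Measurable fun A : Matrix (Fin m) (Fin n) ℝ => A i j :=
  (measurable_pi_apply j).comp (measurable_pi_apply (X := fun _ => Fin n → ℝ) i)

theorem measurable_stepEval (M : StepTraceProduct p p₁ p₂ a n) (α : ℕ → ℝ)
    (S : Weights p p₁ p₂) (t : ℕ) (i : Fin a) (j : Fin n) :
    Measurable fun q : Weights p p₁ p₂ × (ℕ → Fin b → EuclideanSpace ℝ (Fin p)) =>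
      stepEval M α S t q.1 q.2 i j := by
  refine stepEval_mem (A := measurableSubalgebra _) M α S t _ _ (fun i j => ?_) (fun i j => ?_)
    (fun t i j => ?_) i j
  · exact (measurable_entry i j).comp (measurable_fst.comp measurable_fst)
  · exact (measurable_entry i j).comp (measurable_snd.comp measurable_fst)
  · change Measurable fun q : Weights p p₁ p₂ × (ℕ → Fin b → EuclideanSpace ℝ (Fin p)) =>
      q.2 t i j
    fun_prop

end Membership

/-! ### Freezing the initial weights, and the theorem. -/

section ConditionalExpectation

/-- By independence the conditional distribution of `Y` given `X` is the constant kernel with value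
the law of `Y`. The standard Borel assumption on `γ` ensures that this conditional distribution
exists. -/
theorem condExp_ae_eq_integral_of_indepFun {Ω β γ : Type*} [MeasurableSpace Ω]
    [mβ : MeasurableSpace β] [MeasurableSpace γ] [StandardBorelSpace γ] [Nonempty γ]
    {μ : Measure Ω} [IsProbabilityMeasure μ] {X : Ω → β} {Y : Ω → γ} (hX : Measurable X)
    (hY : Measurable Y) (hXY : IndepFun X Y μ) {f : β × γ → ℝ} (hf : Measurable f)
    (hint : Integrable (fun ω => f (X ω, Y ω)) μ) :
    μ[fun ω => f (X ω, Y ω) | mβ.comap X] =ᵐ[μ] fun ω => ∫ ω', f (X ω, Y ω') ∂μ := by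
  have := Measure.isProbabilityMeasure_map (μ := μ) hX.aemeasurable
  have := Measure.isProbabilityMeasure_map (μ := μ) hY.aemeasurable
  have h1 : condDistrib Y X μ =ᵐ[μ.map X] Kernel.const β (μ.map Y) := by
    refine condDistrib_ae_eq_of_measure_eq_compProd X hY.aemeasurable ?_
    rw [Measure.compProd_const]
    exact (indepFun_iff_map_prod_eq_prod_map_map hX.aemeasurable hY.aemeasurable).1 hXY
  refine (condExp_prod_ae_eq_integral_condDistrib hX hY.aemeasurable hf.stronglyMeasurable
    hint).trans ?_
  filter_upwards [ae_of_ae_map hX.aemeasurable h1] with ω hω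
  rw [hω, Kernel.const_apply, integral_map hY.aemeasurable]
  exact (hf.comp (measurable_const.prodMk measurable_id)).aestronglyMeasurable

end ConditionalExpectation

theorem HasFiniteMoments.mem_momentSubalgebra {Ω : Type*} [MeasurableSpace Ω] {μ : Measure Ω}
    [IsFiniteMeasure μ] {p p₁ p₂ : ℕ} {W₀ : Ω → Weights p p₁ p₂} (h : HasFiniteMoments μ W₀)
    (hW : Measurable W₀) :
    (∀ i j, (fun ω => (W₀ ω).1 i j) ∈ momentSubalgebra μ) ∧
      ∀ i j, (fun ω => (W₀ ω).2 i j) ∈ momentSubalgebra μ :=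
  ⟨fun i j => ⟨((measurable_entry i j).comp (measurable_fst.comp hW)).aestronglyMeasurable,
      fun r => (h r).1 i j⟩,
    fun i j => ⟨((measurable_entry i j).comp (measurable_snd.comp hW)).aestronglyMeasurable,
      fun r => (h r).2 i j⟩⟩

/-- Sorting a list of terms by the exponent of `β`. -/
theorem sum_pow_smul_evalSum_filter {ι : Type} {r c : ι → ℕ} {a n : ℕ}
    (V : (s : ι) → Matrix (Fin (r s)) (Fin (c s)) ℝ) (β : ℝ) (q : ℕ)
    (N : List (ℝ × ℕ × TraceProduct r c a n)) (hN : ∀ s ∈ N, s.2.1 ≤ q) (i : Fin a) (j : Fin n) :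
    (∑ k ∈ Finset.range (q + 1), β ^ k •
      evalSum V ((N.filter fun s => s.2.1 = k).map fun s => (s.1, s.2.2))) i j =
      (N.map fun s => s.1 * β ^ s.2.1 * s.2.2.eval V i j).sum := by
  have h : ∀ k, (β ^ k • evalSum V ((N.filter fun s => s.2.1 = k).map fun s => (s.1, s.2.2))) i j =
      (N.map fun s => if s.2.1 = k then s.1 * β ^ s.2.1 * s.2.2.eval V i j else 0).sum := by
    intro k
    rw [Matrix.smul_apply, evalSum, Matrix.list_sum_map_apply, List.map_map, smul_eq_mul,
      ← List.sum_map_mul_left]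
    clear hN
    induction N with
    | nil => simp
    | cons s N ih =>
      rw [List.filter_cons]
      by_cases hs : s.2.1 = k
      · simp only [hs, decide_true, if_true, List.map_cons, List.sum_cons, ih]
        simp only [Function.comp_apply, Matrix.smul_apply, smul_eq_mul]
        ring
      · simp only [hs, decide_false, if_false, List.map_cons, List.sum_cons, zero_add,
          Bool.false_eq_true]
        exact ih
  rw [Matrix.sum_apply]
  simp only [h, Finset.sum_list_sum_map]
  congr 1
  refine List.map_congr_left fun s hs => ?_
  rw [Finset.sum_ite_eq, if_pos (Finset.mem_range.2 (Nat.lt_succ_of_le (hN s hs)))]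

theorem mainTheorem4 (p p₁ p₂ : ℕ) (α : ℕ → ℝ) (t : ℕ) (a n : ℕ)
    (M : StepTraceProduct p p₁ p₂ a n) :
    ∃ (q : ℕ) (N : ℕ → List (ℝ × WeightTraceProduct p p₁ p₂ a n)),
      (q : ℝ) ≤ 1 / 2 * (3 ^ (t + 1) - 1) * M.gradDegree
        + 1 / 2 * (3 ^ t - 1) * M.studentDegree ∧
      (∀ k ≤ q, ∀ s ∈ N k,
        s.1 ∈ Algebra.adjoin ℤ (α '' Set.Iio t) ∧
        s.2.totalDegree ≤ 3 ^ t * (3 * M.gradDegree + M.studentDegree)) ∧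
      ∀ (b : ℕ), 1 ≤ b → ∀ (S : Weights p p₁ p₂)
        (Ω : Type*) [MeasurableSpace Ω] (μ : Measure Ω) [IsProbabilityMeasure μ]
        (W₀ : Ω → Weights p p₁ p₂) (x : ℕ → Fin b → Ω → EuclideanSpace ℝ (Fin p)),
        IsOnlineSample μ W₀ x →
        ∀ (i : Fin a) (j : Fin n),
          (HasFiniteMoments μ W₀ → Integrable (fun ω => M.atStep α S W₀ x t ω i j) μ) ∧
          (Integrable (fun ω => M.atStep α S W₀ x t ω i j) μ →
            μ[fun ω => M.atStep α S W₀ x t ω i j | initSigma W₀] =ᵐ[μ] fun ω =>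
              (∑ k ∈ Finset.range (q + 1),
                (1 / (b : ℝ)) ^ k • evalSum (weightValue S (W₀ ω)) (N k)) i j) := by
  obtain ⟨N, hN, hN'⟩ := IsGaussianFunctional.exists_expectation α t M
  -- The bound itself serves as `q`; `N k` collects the terms with exponent `k` and may be empty.
  refine ⟨geomThree (t + 1) * M.gradDegree + geomThree t * M.studentDegree,
    fun k => (N.filter fun s => s.2.1 = k).map fun s => (s.1, s.2.2), ?_, ?_, ?_⟩
  · push_cast
    rw [geomThree_cast, geomThree_cast]
  · intro k _ s hs
    obtain ⟨u, hu, rfl⟩ := List.mem_map.1 hs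
    have h := hN u (List.mem_filter.1 hu).1
    exact ⟨h.1, h.2.2⟩
  · intro b hb S Ω _ μ _ W₀ x h i j
    have hx : Measurable fun ω t i => x t i ω := by
      have := h.measurable_sample
      fun_prop
    simp only [StepTraceProduct.atStep_eq]
    refine ⟨fun hW => ?_, fun hint => ?_⟩
    · obtain ⟨h1, h2⟩ := hW.mem_momentSubalgebra h.measurable_init
      exact integrable_of_mem_momentSubalgebra (stepEval_mem M α S t W₀ (fun ω t i => x t i ω)
        h1 h2 (fun t i j => h.sampleCoord_mem ((t, i), j)) i j)
    -- With $W_0(\omega)$ frozen, the integrand is a polynomial in the samples alone. Integrability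
    -- of the given entry is therefore enough, and no moments of the initial weights are needed.
    · refine (condExp_ae_eq_integral_of_indepFun h.measurable_init hx h.indep_init
        (measurable_stepEval M α S t i j) hint).trans (ae_of_all _ fun ω => ?_)
      have h1 := h.integral_stepEval M α S (W₀ ω) t i j
      rw [hN' b hb S (W₀ ω) _ (isGaussianFunctional_polyExpectation
        h.measurable_sampleCoord h.map_sampleCoord h.iIndepFun_sampleCoord h.sampleCoord_mem)] at h1
      exact h1.trans (sum_pow_smul_evalSum_filter (weightValue S (W₀ ω)) (1 / (b : ℝ)) _ N
        (fun s hs => (hN s hs).2.1) i j).symm
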